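/- For a permutation $\sigma$ of $[n]=\{1,\dots,n\}$, let $\mathrm{fp}(\sigma)$, $\mathrm{exc}(\sigma)$ and $\mathrm{inv}(\sigma)$ be the numbers of indices $i$ with $\sigma(i)=i$, of indices $i$ with $\sigma(i)>i$, and of pairs $i<j$ with $\sigma(i)>\sigma(j)$. Let $\mathrm{crs}(\sigma)$ be the number of crossings, i.e. pairs $(i,j)$ with $i<j<\sigma(i)<\sigma(j)$ or $\sigma(i)<\sigma(j)\le i<j$, and let $\mathrm{nes}(\sigma)$ be the number of nestings, i.e. pairs $(i,j)$ with $i<j<\sigma(j)<\sigma(i)$ or $\sigma(j)<\sigma(i)\le i<j$. For a pattern $\tau$, let $S_n(\tau)$ be the set of permutations of $[n]$ that have no subsequence with the same relative order as $\tau$. Two patterns $\tau,\tau'\in S_3$ are called $(\mathrm{st}_1,\dots,\mathrm{st}_k)$-Wilf equivalent if, for every $n$, $$\sum_{\sigma\in S_n(\tau)}x_1^{\mathrm{st}_1(\sigma)}\cdots x_k^{\mathrm{st}_k(\sigma)}=\sum_{\sigma\in S_n(\tau')}x_1^{\mathrm{st}_1(\sigma)}\cdots x_k^{\mathrm{st}_k(\sigma)},$$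 and $[\tau]_{\mathrm{st}_1,\dots,\mathrm{st}_k}\subseteq S_3$ denotes the equivalence class of $\tau$. **Theorem.** For patterns in $S_3$: (i) $[132]_{\mathrm{fp},\mathrm{exc},\mathrm{inv},\mathrm{crs},\mathrm{nes}}=\{132,213\}$, and this is the only $(\mathrm{fp},\mathrm{exc},\mathrm{inv},\mathrm{crs},\mathrm{nes})$-Wilf-equivalence class with more than one element; (ii) $[231]_{\mathrm{fp},\mathrm{inv},\mathrm{nes}}=\{231,312\}$, and the $(\mathrm{fp},\mathrm{inv},\mathrm{nes})$-Wilf-equivalence classes with more than one element are exactly $\{132,213\}$ and $\{231,312\}$; (iii) $[132]_{\mathrm{fp},\mathrm{exc},\mathrm{crs}}=\{132,213,321\}$, and this is the only $(\mathrm{fp},\mathrm{exc},\mathrm{crs})$-Wilf-equivalence class with more than one element. -/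

import Mathlib

namespace PermPattern

/-- A statistic on permutations: a natural number attached to every permutation of every length.
Permutations of length `n` are written on the index set `Fin n = {0, …, n - 1}`; all notions
below are invariant under the shift to `{1, …, n}`. -/
abbrev Stat : Type := ∀ n : ℕ, Equiv.Perm (Fin n) → ℕ

/-- Number of fixed points. -/
def fp : Stat := fun n σ =>
  (Finset.univ.filter fun i : Fin n => σ i = i).card

/-- Number of excedances: indices `i` with `σ i > i`. -/
def exc : Stat := fun n σ =>
  (Finset.univ.filter fun i : Fin n => i < σ i).card

/-- Number of inversions: pairs `(i, j)` with `i < j` and `σ i > σ j`. -/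
def inv : Stat := fun n σ =>
  (Finset.univ.filter fun p : Fin n × Fin n => p.1 < p.2 ∧ σ p.2 < σ p.1).card

/-- Number of crossings: pairs `(i, j)` with `i < j < σ i < σ j` or `σ i < σ j ≤ i < j`. -/
def crs : Stat := fun n σ =>
  (Finset.univ.filter fun p : Fin n × Fin n =>
    (p.1 < p.2 ∧ p.2 < σ p.1 ∧ σ p.1 < σ p.2) ∨
    (σ p.1 < σ p.2 ∧ σ p.2 ≤ p.1 ∧ p.1 < p.2)).card

/-- Number of nestings: pairs `(i, j)` with `i < j < σ j < σ i` or `σ j < σ i ≤ i < j`. -/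
def nes : Stat := fun n σ =>
  (Finset.univ.filter fun p : Fin n × Fin n =>
    (p.1 < p.2 ∧ p.2 < σ p.2 ∧ σ p.2 < σ p.1) ∨
    (σ p.2 < σ p.1 ∧ σ p.1 ≤ p.1 ∧ p.1 < p.2)).card

/-- `σ` contains the pattern `τ`: for some positions `f 0 < f 1 < ⋯ < f (k - 1)`, the
subsequence `σ (f 0), …, σ (f (k - 1))` has the same relative order as `τ`, that is, its
reduction is `τ`. -/
def Contains {k n : ℕ} (σ : Equiv.Perm (Fin n)) (τ : Equiv.Perm (Fin k)) : Prop :=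
  ∃ f : Fin k → Fin n, StrictMono f ∧ ∀ a b : Fin k, σ (f a) < σ (f b) ↔ τ a < τ b

open Classical in
/-- `S_n(T)`: the permutations of length `n` avoiding every pattern in the set `T`
(patterns of arbitrary lengths). -/
noncomputable def avoiders (T : Set (Σ k : ℕ, Equiv.Perm (Fin k))) (n : ℕ) :
    Finset (Equiv.Perm (Fin n)) :=
  Finset.univ.filter fun σ => ∀ τ ∈ T, ¬ Contains σ τ.2

/-- The joint generating polynomial `∑_{σ ∈ S_n(T)} ∏_i x_i ^ st_i(σ)` of a finite family of
statistics. -/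
noncomputable def genPoly {ι : Type*} [Fintype ι] (st : ι → Stat)
    (T : Set (Σ k : ℕ, Equiv.Perm (Fin k))) (n : ℕ) : MvPolynomial ι ℤ :=
  ∑ σ ∈ avoiders T n, ∏ i, MvPolynomial.X i ^ st i n σ

/-- Wilf equivalence of two sets of patterns with respect to a finite family of statistics:
the joint distributions agree on `S_n(T)` and `S_n(T')` for every `n`. -/
def WilfEquiv {ι : Type*} [Fintype ι] (st : ι → Stat)
    (T T' : Set (Σ k : ℕ, Equiv.Perm (Fin k))) : Prop :=
  ∀ n : ℕ, genPoly st T n = genPoly st T' n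

/-- The Wilf-equivalence class `[τ]_st` among single patterns of the same length `k`. -/
def wilfClass {ι : Type*} [Fintype ι] (st : ι → Stat) {k : ℕ} (τ : Equiv.Perm (Fin k)) :
    Set (Equiv.Perm (Fin k)) :=
  {τ' | WilfEquiv st {⟨k, τ⟩} {⟨k, τ'⟩}}

/-- The Wilf-equivalence classes of single patterns of length `k` that have at least two
elements. -/
def nonSingletonClasses {ι : Type*} [Fintype ι] (st : ι → Stat) (k : ℕ) :
    Set (Set (Equiv.Perm (Fin k))) :=
  {C | (∃ τ : Equiv.Perm (Fin k), C = wilfClass st τ) ∧ C.Nontrivial}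

/-- The permutation `132` (one-line notation, with values shifted down by one below). -/
def p132 : Equiv.Perm (Fin 3) := ⟨![0, 2, 1], ![0, 2, 1], by decide, by decide⟩

/-- The permutation `213`. -/
def p213 : Equiv.Perm (Fin 3) := ⟨![1, 0, 2], ![1, 0, 2], by decide, by decide⟩

/-- The permutation `231`. -/
def p231 : Equiv.Perm (Fin 3) := ⟨![1, 2, 0], ![2, 0, 1], by decide, by decide⟩

/-- The permutation `312`. -/
def p312 : Equiv.Perm (Fin 3) := ⟨![2, 0, 1], ![1, 2, 0], by decide, by decide⟩

/-- The permutation `321`. -/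
def p321 : Equiv.Perm (Fin 3) := ⟨![2, 1, 0], ![2, 1, 0], by decide, by decide⟩

end PermPattern

namespace PermPattern

/-! ### Pattern containment under inversion and anti-transposition -/

open Finset

/-! Among permutations of length 3 only `τ` itself contains `τ`, so equivalent patterns have equal
statistics as permutations (`WilfEquiv.stat_eq`). A check of the six patterns then bounds every
class from above. Three equivalences remain. Anti-transposition preserves all five statistics and
exchanges 132 with 213. Inversion preserves `fp`, `inv` and `nes` and exchanges 231 with 312. The
hard one is 132 with 321 for `(fp, exc, crs)`, where no bijection is given: both generating
polynomials are shown to be `motzkinSum x y q n 0`, the moments of one J-fraction.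

In each case `x ^ fp * y ^ exc * q ^ crs` becomes a product of weights of single points of the
graph. For 321 the weight depends only on the cell (`Avoids321.crs_eq`); for 132 also on the number
of points to the lower left (`Avoids132.crs_eq`).

The sums are then generalised to permutations whose graph misses a rectangle in the upper right
corner. A point next to the rectangle is either present, and is removed, or absent, and the
rectangle grows. For 321 an `h` by `h` rectangle suffices, and peeling a row and a column gives the
three-term recursion of `motzkinSum`. For 132 rectangles of all shapes `a` by `b` occur, each with
its own diagonal, shifted by about `(b - a) / 2`; each peeling is half a Motzkin step, and two of
them compose to the same recursion. -/

theorem mem_avoiders_singleton {k n : ℕ} {τ : Equiv.Perm (Fin k)} {σ : Equiv.Perm (Fin n)} :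
    σ ∈ avoiders {⟨k, τ⟩} n ↔ ¬ Contains σ τ := by
  classical
  simp [avoiders]

theorem contains_same_length_iff {k : ℕ} {σ τ : Equiv.Perm (Fin k)} :
    Contains σ τ ↔ σ = τ := by
  constructor
  · rintro ⟨f, hf, h⟩
    have hid : f = id := by
      have : Set.range f = Set.univ :=
        (Finite.injective_iff_surjective.1 hf.injective).range_eq
      exact StrictMono.range_inj hf strictMono_id |>.1 (by simp [this])
    subst hid
    have hm : StrictMono (σ ∘ τ.symm) := by
      intro a b hab
      have := (h (τ.symm a) (τ.symm b)).2 (by simpa using hab)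
      simpa using this
    have : (σ ∘ τ.symm : Fin k → Fin k) = id := by
      exact StrictMono.range_inj hm strictMono_id |>.1 (by simp)
    ext i
    have := congrFun this (τ i)
    simp at this
    simp [this]
  · rintro rfl
    exact ⟨id, strictMono_id, fun _ _ => Iff.rfl⟩

theorem Contains.inverse {k n : ℕ} {σ : Equiv.Perm (Fin n)} {τ : Equiv.Perm (Fin k)}
    (h : Contains σ τ) : Contains σ⁻¹ τ⁻¹ := by
  obtain ⟨f, hf, h⟩ := h
  refine ⟨fun a => σ (f (τ⁻¹ a)), fun a b hab => ?_, fun a b => ?_⟩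
  · rw [h]; simpa using hab
  · simp [hf.lt_iff_lt]

theorem contains_inv_iff {k n : ℕ} {σ : Equiv.Perm (Fin n)} {τ : Equiv.Perm (Fin k)} :
    Contains σ⁻¹ τ⁻¹ ↔ Contains σ τ :=
  ⟨fun h => by simpa using h.inverse, Contains.inverse⟩

/-- Reflection of the graph of a permutation in the anti-diagonal. -/
def antiTranspose {n : ℕ} (σ : Equiv.Perm (Fin n)) : Equiv.Perm (Fin n) :=
  Fin.revPerm * σ⁻¹ * Fin.revPerm

theorem antiTranspose_antiTranspose {n : ℕ} (σ : Equiv.Perm (Fin n)) :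
    antiTranspose (antiTranspose σ) = σ := by
  ext i
  simp [antiTranspose]

theorem antiTranspose_apply_rev {n : ℕ} (σ : Equiv.Perm (Fin n)) (i : Fin n) :
    antiTranspose σ (σ i).rev = i.rev := by
  simp [antiTranspose]

theorem Contains.antiTranspose {k n : ℕ} {σ : Equiv.Perm (Fin n)} {τ : Equiv.Perm (Fin k)}
    (h : Contains σ τ) : Contains (antiTranspose σ) (antiTranspose τ) := by
  obtain ⟨f, hf, h⟩ := h.inverse
  refine ⟨fun a => (f a.rev).rev, fun a b hab => ?_, fun a b => ?_⟩
  · simpa using hf (Fin.rev_lt_rev.2 hab)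
  · simpa [PermPattern.antiTranspose] using h b.rev a.rev

theorem contains_antiTranspose_iff {k n : ℕ} {σ : Equiv.Perm (Fin n)} {τ : Equiv.Perm (Fin k)} :
    Contains (antiTranspose σ) (antiTranspose τ) ↔ Contains σ τ :=
  ⟨fun h => by simpa [antiTranspose_antiTranspose] using h.antiTranspose, Contains.antiTranspose⟩

/-! ### Wilf equivalence: necessary conditions and bijections -/

section WilfEquiv

variable {ι : Type*} [Fintype ι] {st : ι → Stat}

theorem WilfEquiv.refl (T : Set (Σ k : ℕ, Equiv.Perm (Fin k))) : WilfEquiv st T T := fun _ => rfl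

theorem WilfEquiv.symm {T T' : Set (Σ k : ℕ, Equiv.Perm (Fin k))} (h : WilfEquiv st T T') :
    WilfEquiv st T' T := fun n => (h n).symm

theorem WilfEquiv.trans {T T' T'' : Set (Σ k : ℕ, Equiv.Perm (Fin k))} (h : WilfEquiv st T T')
    (h' : WilfEquiv st T' T'') : WilfEquiv st T T'' := fun n => (h n).trans (h' n)

theorem prod_X_pow_injective {a b : ι → ℕ}
    (h : ∏ i, (MvPolynomial.X i : MvPolynomial ι ℤ) ^ a i = ∏ i, MvPolynomial.X i ^ b i) :
    a = b := by
  classical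
  have key : ∀ c : ι → ℕ, ∏ i, (MvPolynomial.X i : MvPolynomial ι ℤ) ^ c i =
      MvPolynomial.monomial (Finsupp.equivFunOnFinite.symm c) 1 := by
    intro c
    rw [MvPolynomial.monomial_eq, Finsupp.prod_fintype _ _ (by simp)]
    simp
  rw [key, key] at h
  have := MvPolynomial.monomial_left_injective (one_ne_zero : (1 : ℤ) ≠ 0) h
  exact Finsupp.equivFunOnFinite.symm.injective this

/-- At `n = k` the generating polynomial is the sum over all permutations minus the one monomial of
the pattern, and that monomial determines its exponents. -/
theorem WilfEquiv.stat_eq {k : ℕ} {τ τ' : Equiv.Perm (Fin k)}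
    (h : WilfEquiv st {⟨k, τ⟩} {⟨k, τ'⟩}) (i : ι) : st i k τ = st i k τ' := by
  classical
  have key : ∀ ρ : Equiv.Perm (Fin k), genPoly st {⟨k, ρ⟩} k =
      ∑ σ, (∏ i, MvPolynomial.X i ^ st i k σ) - ∏ i, MvPolynomial.X i ^ st i k ρ := by
    intro ρ
    have : avoiders {⟨k, ρ⟩} k = Finset.univ.erase ρ := by
      ext σ
      simp [mem_avoiders_singleton, contains_same_length_iff]
    rw [genPoly, this, ← Finset.sum_erase_add _ _ (Finset.mem_univ ρ), add_sub_cancel_right]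
  have h' := h k
  rw [key, key, sub_right_inj] at h'
  exact congrFun (prod_X_pow_injective h') i

theorem WilfEquiv.of_equiv {k k' : ℕ} {τ : Equiv.Perm (Fin k)} {τ' : Equiv.Perm (Fin k')}
    (F : ∀ n, Equiv.Perm (Fin n) ≃ Equiv.Perm (Fin n))
    (hF : ∀ n σ, Contains (F n σ) τ' ↔ Contains σ τ)
    (hst : ∀ i n σ, st i n (F n σ) = st i n σ) : WilfEquiv st {⟨k, τ⟩} {⟨k', τ'⟩} := by
  intro n
  refine Finset.sum_equiv (F n) (fun σ => ?_) (fun σ _ => ?_)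
  · simp [mem_avoiders_singleton, hF]
  · simp [hst]

theorem nonSingletonClasses_eq_of_stat {k : ℕ} (S : Set (Set (Equiv.Perm (Fin k))))
    (hS : ∀ C ∈ S, C.Nontrivial ∧ ∃ τ, C = wilfClass st τ)
    (h : ∀ τ τ', τ ≠ τ' → (∀ i, st i k τ = st i k τ') → ∃ C ∈ S, τ ∈ C) :
    nonSingletonClasses st k = S := by
  ext C
  constructor
  · rintro ⟨⟨τ, rfl⟩, hC⟩
    obtain ⟨τ', hτ', hne⟩ := hC.exists_ne τ
    obtain ⟨D, hD, hτD⟩ := h τ τ' hne.symm (WilfEquiv.stat_eq hτ')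
    obtain ⟨-, ρ, rfl⟩ := hS D hD
    have : wilfClass st τ = wilfClass st ρ := by
      ext π
      exact ⟨fun hp => WilfEquiv.trans hτD hp, fun hp => WilfEquiv.trans (WilfEquiv.symm hτD) hp⟩
    rwa [this]
  · intro hC
    exact ⟨(hS C hC).2, (hS C hC).1⟩

end WilfEquiv

/-! ### Invariance of the five statistics under anti-transposition -/

section AntiTranspose

variable {n : ℕ} (σ : Equiv.Perm (Fin n))

/-- The map sending a point of the graph of `σ` to the corresponding point of the
anti-transposed graph. -/
def antiIndex : Equiv.Perm (Fin n) := σ.trans Fin.revPerm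

theorem antiIndex_apply (i : Fin n) : antiIndex σ i = (σ i).rev := by
  simp [antiIndex]

theorem fp_antiTranspose : fp n (antiTranspose σ) = fp n σ := by
  refine (Finset.card_equiv (antiIndex σ) fun i => ?_).symm
  simp [antiTranspose_apply_rev, antiIndex_apply, eq_comm]

theorem exc_antiTranspose : exc n (antiTranspose σ) = exc n σ := by
  refine (Finset.card_equiv (antiIndex σ) fun i => ?_).symm
  simp [antiTranspose_apply_rev, antiIndex_apply]

theorem inv_antiTranspose : inv n (antiTranspose σ) = inv n σ := by
  refine (Finset.card_equiv ((antiIndex σ).prodCongr (antiIndex σ)) fun p => ?_).symm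
  simp [antiTranspose_apply_rev, antiIndex_apply, and_comm]

/-- Anti-transposition reverses the left-to-right order of the two points of a crossing, hence the
swap; the points of an inversion or a nesting keep their order. -/
theorem crs_antiTranspose : crs n (antiTranspose σ) = crs n σ := by
  refine (Finset.card_equiv (((antiIndex σ).prodCongr (antiIndex σ)).trans
    (Equiv.prodComm _ _)) fun ⟨i, j⟩ => ?_).symm
  simp [antiIndex_apply, antiTranspose_apply_rev]
  tauto

theorem nes_antiTranspose : nes n (antiTranspose σ) = nes n σ := by
  refine (Finset.card_equiv (((antiIndex σ).prodCongr (antiIndex σ))) fun ⟨i, j⟩ => ?_).symm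
  simp [antiIndex_apply, antiTranspose_apply_rev]
  tauto

end AntiTranspose

/-! ### Invariance of `fp`, `inv` and `nes` under inversion -/

section Inverse

variable {n : ℕ} (σ : Equiv.Perm (Fin n))

theorem fp_inv : fp n σ⁻¹ = fp n σ := by
  refine (Finset.card_equiv σ fun i => ?_).symm
  simp [eq_comm]

theorem inv_inverse : inv n σ⁻¹ = inv n σ := by
  refine (Finset.card_equiv ((σ.prodCongr σ).trans (Equiv.prodComm _ _)) fun p => ?_).symm
  simp [and_comm]

/-- As many points of the graph lie strictly above as below the diagonal at a given index. -/
theorem card_le_lt_eq_card_lt_le (k : Fin n) :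
    #{i : Fin n | i ≤ k ∧ k < σ i} = #{i : Fin n | k < i ∧ σ i ≤ k} := by
  have h1 : #{i : Fin n | i ≤ k} = #{i : Fin n | σ i ≤ k} :=
    (Finset.card_equiv σ fun i => by simp).symm
  have h2 := Finset.card_filter_add_card_filter_not (s := {i : Fin n | i ≤ k}) (fun i => σ i ≤ k)
  have h3 := Finset.card_filter_add_card_filter_not (s := {i : Fin n | σ i ≤ k}) (fun i => i ≤ k)
  simp only [Finset.filter_filter, not_le] at h2 h3
  have h4 : #{i : Fin n | i ≤ k ∧ σ i ≤ k} = #{i : Fin n | σ i ≤ k ∧ i ≤ k} := by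
    simp only [and_comm]
  have h5 : #{i : Fin n | k < i ∧ σ i ≤ k} = #{i : Fin n | σ i ≤ k ∧ k < i} := by
    simp only [and_comm]
  omega

/-- Inversion exchanges the nestings strictly above the diagonal with those strictly below it. What
is left are the nestings of a fixed point `i` under a point below the diagonal; their number equals
that of the points passing over `i` above the diagonal, by `card_le_lt_eq_card_lt_le`. -/
theorem nes_inv : nes n σ⁻¹ = nes n σ := by
  have key : ∀ τ : Equiv.Perm (Fin n), nes n τ =
      #{p : Fin n × Fin n | p.1 < p.2 ∧ p.2 < τ p.2 ∧ τ p.2 < τ p.1} +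
      #{p : Fin n × Fin n | τ p.2 < τ p.1 ∧ τ p.1 < p.1 ∧ p.1 < p.2} +
      ∑ i, if τ i = i then #{j : Fin n | i < j ∧ τ j ≤ i} else 0 := by
    intro τ
    have h1 : (∑ i, if τ i = i then #{j : Fin n | i < j ∧ τ j ≤ i} else 0) =
        #{p : Fin n × Fin n | τ p.2 < τ p.1 ∧ τ p.1 = p.1 ∧ p.1 < p.2} := by
      rw [Finset.card_filter, Fintype.sum_prod_type]
      refine Finset.sum_congr rfl fun i _ => ?_
      split_ifs with h
      · rw [Finset.card_filter]
        refine Finset.sum_congr rfl fun j _ => ?_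
        congr 1
        simp only [h, true_and, eq_iff_iff]
        constructor
        · rintro ⟨h1, h2⟩
          exact ⟨lt_of_le_of_ne h2 fun h3 => h1.ne' (τ.injective (h3.trans h.symm)), h1⟩
        · rintro ⟨h1, h2⟩
          exact ⟨h2, h1.le⟩
      · simp [h]
    rw [h1, nes, ← Finset.card_union_of_disjoint, ← Finset.card_union_of_disjoint]
    · congr 1
      ext p
      simp only [mem_filter, mem_univ, true_and, mem_union, le_iff_lt_or_eq]
      tauto
    · rw [Finset.disjoint_left]
      intro p
      simp only [mem_filter, mem_univ, true_and, mem_union]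
      rintro (h | h) ⟨h2, h3, h4⟩
      · exact (h.1.trans (h.2.1.trans h.2.2)).ne' h3
      · exact h.2.1.ne h3
    · rw [Finset.disjoint_left]
      intro p
      simp only [mem_filter, mem_univ, true_and]
      rintro h ⟨h2, h3, h4⟩
      exact lt_asymm h3 (h.1.trans (h.2.1.trans h.2.2))
  rw [key, key]
  have e1 : #{p : Fin n × Fin n | p.1 < p.2 ∧ p.2 < σ⁻¹ p.2 ∧ σ⁻¹ p.2 < σ⁻¹ p.1} =
      #{p : Fin n × Fin n | σ p.2 < σ p.1 ∧ σ p.1 < p.1 ∧ p.1 < p.2} := by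
    refine (Finset.card_equiv ((σ.prodCongr σ).trans (Equiv.prodComm _ _)) fun p => ?_).symm
    simp
  have e2 : #{p : Fin n × Fin n | σ⁻¹ p.2 < σ⁻¹ p.1 ∧ σ⁻¹ p.1 < p.1 ∧ p.1 < p.2} =
      #{p : Fin n × Fin n | p.1 < p.2 ∧ p.2 < σ p.2 ∧ σ p.2 < σ p.1} := by
    refine (Finset.card_equiv ((σ.prodCongr σ).trans (Equiv.prodComm _ _)) fun p => ?_).symm
    simp
  have e3 : ∀ i, (if σ⁻¹ i = i then #{j : Fin n | i < j ∧ σ⁻¹ j ≤ i} else 0) =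
      if σ i = i then #{j : Fin n | i < j ∧ σ j ≤ i} else 0 := by
    intro i
    have : σ⁻¹ i = i ↔ σ i = i := by
      rw [Equiv.Perm.inv_eq_iff_eq, eq_comm]
    simp only [this]
    congr 1
    rw [← card_le_lt_eq_card_lt_le]
    refine (Finset.card_equiv σ fun j => ?_).symm
    simp [and_comm]
  rw [e1, e2, Finset.sum_congr rfl fun i _ => e3 i]
  omega

end Inverse

/-! ### Inserting a point into the graph of a permutation -/

section InsertPoint

variable {n : ℕ}

/-- The permutation obtained from `σ` by adding to its graph a new point in column `p` and
row `v`. -/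
def insertPoint (p v : Fin (n + 1)) (σ : Equiv.Perm (Fin n)) : Equiv.Perm (Fin (n + 1)) :=
  (finSuccEquiv' p).trans (σ.optionCongr.trans (finSuccEquiv' v).symm)

@[simp]
theorem insertPoint_apply_self (p v : Fin (n + 1)) (σ : Equiv.Perm (Fin n)) :
    insertPoint p v σ p = v := by
  simp [insertPoint]

@[simp]
theorem insertPoint_apply_succAbove (p v : Fin (n + 1)) (σ : Equiv.Perm (Fin n)) (i : Fin n) :
    insertPoint p v σ (p.succAbove i) = v.succAbove (σ i) := by
  simp [insertPoint]

theorem insertPoint_injective (p v : Fin (n + 1)) : Function.Injective (insertPoint p v) := by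
  intro σ τ h
  ext i
  have := congrArg (fun ρ => ρ (p.succAbove i)) h
  simp only [insertPoint_apply_succAbove, Fin.succAbove_right_inj] at this
  rw [this]

theorem exists_insertPoint_eq {p v : Fin (n + 1)} {σ : Equiv.Perm (Fin (n + 1))} (h : σ p = v) :
    ∃ τ, insertPoint p v τ = σ := by
  have h1 : ∀ i : Fin n, σ (p.succAbove i) ≠ v := fun i hi =>
    Fin.succAbove_ne p i (σ.injective (hi.trans h.symm))
  choose f hf using fun i => Fin.exists_succAbove_eq (h1 i)
  have hinj : Function.Injective f := by
    intro i j hij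
    have := (hf i).symm.trans ((congrArg _ hij).trans (hf j))
    simpa using this
  refine ⟨Equiv.ofBijective f (Finite.injective_iff_bijective.1 hinj), ?_⟩
  refine Equiv.ext fun i => ?_
  rcases Fin.eq_self_or_eq_succAbove p i with rfl | ⟨j, rfl⟩
  · simp [h]
  · simp [hf]

open Classical in
theorem sum_filter_apply_eq {R : Type*} [AddCommMonoid R] (p v : Fin (n + 1))
    (P : Equiv.Perm (Fin (n + 1)) → Prop) (F : Equiv.Perm (Fin (n + 1)) → R) :
    ∑ σ with P σ ∧ σ p = v, F σ = ∑ σ with P (insertPoint p v σ), F (insertPoint p v σ) := by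
  refine (Finset.sum_bij (fun σ _ => insertPoint p v σ) ?_ ?_ ?_ ?_).symm
  · intro σ hσ
    simpa using hσ
  · intro σ _ τ _ h
    exact insertPoint_injective p v h
  · intro σ hσ
    obtain ⟨τ, rfl⟩ := exists_insertPoint_eq (mem_filter.1 hσ).2.2
    exact ⟨τ, by simpa using hσ, rfl⟩
  · intro σ _
    rfl

theorem val_succAbove (p : Fin (n + 1)) (i : Fin n) :
    (p.succAbove i : ℕ) = if (i : ℕ) < p then (i : ℕ) else i + 1 := by
  rw [Fin.succAbove]
  simp only [Fin.lt_def, Fin.val_castSucc]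
  split_ifs <;> simp

end InsertPoint

/-! ### The recursion for 321-avoiding permutations -/

section Avoids321

/-- `σ` has no decreasing subsequence of length three. -/
def Avoids321 {n : ℕ} (σ : Equiv.Perm (Fin n)) : Prop :=
  ∀ i j k, i < j → j < k → σ j < σ i → σ k < σ j → False

theorem Avoids321.inverse {n : ℕ} {σ : Equiv.Perm (Fin n)} (h : Avoids321 σ) :
    Avoids321 σ⁻¹ := by
  intro i j k hij hjk h1 h2
  exact h (σ⁻¹ k) (σ⁻¹ j) (σ⁻¹ i) h2 h1 (by simpa using hjk) (by simpa using hij)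

theorem not_contains_p321_iff {n : ℕ} {σ : Equiv.Perm (Fin n)} :
    ¬ Contains σ p321 ↔ Avoids321 σ := by
  constructor
  · intro h i j k hij hjk h1 h2
    refine h ⟨![i, j, k], ?_, ?_⟩
    · rw [Fin.strictMono_iff_lt_succ]
      intro a
      fin_cases a <;> simpa
    · have h3 := h2.trans h1
      intro a b
      fin_cases a <;> fin_cases b <;> simp [p321, h1, h2, h3, h1.le, h2.le, h3.le]
  · rintro h ⟨f, hf, hp⟩
    exact h (f 0) (f 1) (f 2) (hf (by decide)) (hf (by decide)) ((hp 1 0).2 (by decide))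
      ((hp 2 1).2 (by decide))

/-- The `321`-avoiding permutations of length `N` whose last `v` positions are disjoint from the
positions of the largest `p` values. -/
def Corner321 (N v p : ℕ) (σ : Equiv.Perm (Fin N)) : Prop :=
  Avoids321 σ ∧ ∀ i : Fin N, (i : ℕ) + v < N ∨ (σ i : ℕ) + p < N

theorem Corner321.inverse {N v p : ℕ} {σ : Equiv.Perm (Fin N)} (h : Corner321 N v p σ) :
    Corner321 N p v σ⁻¹ :=
  ⟨h.1.inverse, fun i => by simpa [or_comm] using h.2 (σ⁻¹ i)⟩

theorem corner321_inverse_iff {N v p : ℕ} {σ : Equiv.Perm (Fin N)} :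
    Corner321 N p v σ⁻¹ ↔ Corner321 N v p σ :=
  ⟨fun h => by simpa using h.inverse, Corner321.inverse⟩

variable {R : Type*} [CommSemiring R]

open Classical in
/-- Sum over `Corner321 N v p` of the products of the weights `φ j (σ j)`. -/
noncomputable def sum321 (φ : ℕ → ℕ → R) (N v p : ℕ) : R :=
  ∑ σ : Equiv.Perm (Fin N) with Corner321 N v p σ, ∏ j : Fin N, φ j (σ j)

theorem sum321_transpose (φ : ℕ → ℕ → R) (N v p : ℕ) :
    sum321 (fun a b => φ b a) N p v = sum321 φ N v p := by
  classical
  refine (Finset.sum_equiv (Equiv.inv (Equiv.Perm (Fin N))) (fun σ => ?_) (fun σ _ => ?_)).symm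
  · simp [corner321_inverse_iff]
  · exact Fintype.prod_equiv σ _ _ (by simp)

theorem sum321_congr {φ ψ : ℕ → ℕ → R} {N v p : ℕ}
    (h : ∀ j w, j < N → w < N → (j + v < N ∨ w + p < N) → φ j w = ψ j w) :
    sum321 φ N v p = sum321 ψ N v p := by
  classical
  refine Finset.sum_congr rfl fun σ hσ => Finset.prod_congr rfl fun j _ => ?_
  exact h _ _ j.2 (σ j).2 ((mem_filter.1 hσ).2.2 j)

theorem card_filter_le_val_add {N p : ℕ} (hp : p ≤ N) : #{j : Fin N | N ≤ (j : ℕ) + p} = p := by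
  have := Fin.card_filter_val_lt (n := N) (m := N - p)
  have h2 := Finset.card_filter_add_card_filter_not (s := (univ : Finset (Fin N)))
    (fun j => (j : ℕ) < N - p)
  have h3 : #{j : Fin N | N ≤ (j : ℕ) + p} = #{j : Fin N | ¬ (j : ℕ) < N - p} := by
    congr 1
    ext j
    simp only [mem_filter, mem_univ, true_and]
    omega
  simp at this h2
  omega

theorem prod_ite_le_val_add {N p : ℕ} (hp : p ≤ N) (σ : Equiv.Perm (Fin N)) (q : R) :
    ∏ j, (if N ≤ (σ j : ℕ) + p then q else 1) = q ^ p := by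
  rw [Equiv.prod_comp σ fun j : Fin N => if N ≤ (j : ℕ) + p then q else 1,
    Finset.prod_ite, Finset.prod_const, card_filter_le_val_add hp]
  simp

/-- Each of the top `p` rows holds exactly one point. -/
theorem sum321_mul_top (φ : ℕ → ℕ → R) (q : R) {N p : ℕ} (v : ℕ) (hp : p ≤ N) :
    sum321 (fun j w => (if N ≤ w + p then q else 1) * φ j w) N v p = q ^ p * sum321 φ N v p := by
  classical
  rw [sum321, sum321, Finset.mul_sum]
  refine Finset.sum_congr rfl fun σ _ => ?_
  rw [Finset.prod_mul_distrib, prod_ite_le_val_add hp]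

/-- The weight seen by the remaining points when column `c` is removed. -/
def shiftColumn (c : ℕ) (φ : ℕ → ℕ → R) (j w : ℕ) : R :=
  if c ≤ j then φ (j + 1) w else φ j w

/-- The new point could only be the 3 of a 321 whose other points lie in the last `v` columns. If `p
≠ 0`, the old maximum lies left of these columns and already completes a 321; if `p = 0`, there are
too few columns. -/
theorem corner321_insertPoint_iff {N v p : ℕ} (hp : p = 0 → v ≤ 1) (hvN : v ≤ N)
    (σ : Equiv.Perm (Fin N)) :
    Corner321 (N + 1) v (p + 1)
      (insertPoint ⟨N - v, by omega⟩ (Fin.last N) σ) ↔ Corner321 N v p σ := by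
  set c : Fin (N + 1) := ⟨N - v, by omega⟩ with hc
  have hcv : (c : ℕ) = N - v := rfl
  constructor
  · rintro ⟨h1, h2⟩
    refine ⟨fun i j k hij hjk h3 h4 => ?_, fun i => ?_⟩
    · refine h1 (c.succAbove i) (c.succAbove j) (c.succAbove k) ?_ ?_ ?_ ?_ <;> simpa
    · have := h2 (c.succAbove i)
      rw [insertPoint_apply_succAbove, val_succAbove, Fin.succAbove_last, Fin.val_castSucc] at this
      split_ifs at this <;> omega
  · rintro ⟨h1, h2⟩
    refine ⟨fun i j k hij hjk h3 h4 => ?_, fun i => ?_⟩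
    · rcases Fin.eq_self_or_eq_succAbove c j with rfl | ⟨j, rfl⟩
      · rw [insertPoint_apply_self] at h3
        exact absurd h3 (Fin.le_last _).not_gt
      rcases Fin.eq_self_or_eq_succAbove c k with rfl | ⟨k, rfl⟩
      · rw [insertPoint_apply_self] at h4
        exact absurd h4 (Fin.le_last _).not_gt
      rcases Fin.eq_self_or_eq_succAbove c i with rfl | ⟨i, rfl⟩
      · simp only [insertPoint_apply_succAbove, Fin.succAbove_lt_succAbove_iff] at h4 hjk
        rw [Fin.lt_def, val_succAbove] at hij
        have hj : N - v ≤ j := by split_ifs at hij <;> omega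
        have hjk' : (j : ℕ) < k := hjk
        have hp0 : p ≠ 0 := by
          intro h0
          have := hp h0
          omega
        have hN : 0 < N := by omega
        let t : Fin N := σ⁻¹ ⟨N - 1, by omega⟩
        have ht : σ t = ⟨N - 1, by omega⟩ := by simp [t]
        have h5 := h2 t
        rw [ht] at h5
        have h5' : (t : ℕ) + v < N := by
          rcases h5 with h | h
          · exact h
          · simp only at h; omega
        have htj : t < j := by rw [Fin.lt_def]; omega
        refine h1 t j k htj hjk ?_ h4
        refine lt_of_le_of_ne ?_ fun h => htj.ne (σ.injective h).symm
        rw [ht, Fin.le_def]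
        simp only
        omega
      · simp only [insertPoint_apply_succAbove, Fin.succAbove_lt_succAbove_iff] at *
        exact h1 i j k hij hjk h3 h4
    · rcases Fin.eq_self_or_eq_succAbove c i with rfl | ⟨i, rfl⟩
      · left
        omega
      · have := h2 i
        rw [insertPoint_apply_succAbove, val_succAbove, Fin.succAbove_last, Fin.val_castSucc]
        split_ifs <;> omega

/-- If the column next to the corner held a point in the top `p + 1` rows other than the maximum,
then the maximum to its left and the last column, whose point is lower, would complete a 321. -/
theorem corner321_succ_iff {N v p : ℕ} (hv : v = 0 → p = 0) (hvN : v ≤ N)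
    (σ : Equiv.Perm (Fin (N + 1))) :
    (Corner321 (N + 1) v (p + 1) σ ∧ σ ⟨N - v, by omega⟩ ≠ Fin.last N) ↔
      Corner321 (N + 1) (v + 1) (p + 1) σ := by
  set c : Fin (N + 1) := ⟨N - v, by omega⟩ with hc
  have hcv : (c : ℕ) = N - v := rfl
  constructor
  · rintro ⟨⟨h1, h2⟩, h3⟩
    refine ⟨h1, fun i => ?_⟩
    rcases lt_trichotomy (i : ℕ) (N - v) with hi | hi | hi
    · left; omega
    · right
      obtain rfl : i = c := Fin.ext hi
      by_contra h4
      have h3' : (σ c : ℕ) ≠ N := fun h => h3 (Fin.ext h)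
      have := (σ c).2
      have hv0 : v ≠ 0 := fun h0 => by have := hv h0; omega
      let t : Fin (N + 1) := σ⁻¹ (Fin.last N)
      have ht : σ t = Fin.last N := by simp [t]
      have h5 := h2 t
      rw [ht, Fin.val_last] at h5
      have htc : t < c := by
        rw [Fin.lt_def]
        have : (t : ℕ) ≠ c := fun h => h3 (by rw [← ht]; exact congrArg σ (Fin.ext h.symm))
        omega
      have h6 := h2 (Fin.last N)
      rw [Fin.val_last] at h6
      refine h1 t c (Fin.last N) htc ?_ ?_ ?_
      · rw [Fin.lt_def, Fin.val_last]; omega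
      · rw [ht, Fin.lt_def, Fin.val_last]; omega
      · rw [Fin.lt_def]; omega
    · have := h2 i
      omega
  · rintro ⟨h1, h2⟩
    refine ⟨⟨h1, fun i => ?_⟩, fun h => ?_⟩
    · have := h2 i
      omega
    · have := h2 c
      rw [h, Fin.val_last] at this
      omega

theorem sum321_peel_column (φ : ℕ → ℕ → R) {N v p : ℕ} (hv : v = 0 → p = 0)
    (hp : p = 0 → v ≤ 1) (hvN : v ≤ N) :
    sum321 φ (N + 1) v (p + 1) = sum321 φ (N + 1) (v + 1) (p + 1) +
      φ (N - v) N * sum321 (shiftColumn (N - v) φ) N v p := by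
  classical
  rw [sum321, ← Finset.sum_filter_add_sum_filter_not _
    (fun σ => σ ⟨N - v, by omega⟩ = Fin.last N), Finset.filter_filter, Finset.filter_filter,
    add_comm]
  congr 1
  · rw [sum321]
    congr 1
    ext σ
    simp only [mem_filter, mem_univ, true_and]
    exact corner321_succ_iff hv hvN σ
  · rw [sum_filter_apply_eq, sum321, Finset.mul_sum]
    refine Finset.sum_congr ?_ fun σ _ => ?_
    · ext σ
      simp only [mem_filter, mem_univ, true_and]
      exact corner321_insertPoint_iff hp hvN σ
    · rw [Fin.prod_univ_succAbove _ (⟨N - v, by omega⟩ : Fin (N + 1))]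
      simp only [insertPoint_apply_self, insertPoint_apply_succAbove, Fin.val_last,
        Fin.succAbove_last, Fin.val_castSucc]
      congr 1
      refine Finset.prod_congr rfl fun j _ => ?_
      rw [val_succAbove, shiftColumn]
      simp only
      split_ifs <;> first | rfl | omega

theorem sum321_peel_row (φ : ℕ → ℕ → R) {N v p : ℕ} (hp : p = 0 → v = 0)
    (hv : v = 0 → p ≤ 1) (hpN : p ≤ N) :
    sum321 φ (N + 1) (v + 1) p = sum321 φ (N + 1) (v + 1) (p + 1) +
      φ N (N - p) *
        sum321 (fun j w => shiftColumn (N - p) (fun a b => φ b a) w j) N v p := by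
  rw [← sum321_transpose φ, ← sum321_transpose φ, sum321_peel_column _ hp hv hpN]
  congr 2
  exact sum321_transpose (fun j w => shiftColumn (N - p) (fun a b => φ b a) w j) N v p

/-- The moments of the J-fraction with diagonal coefficients `x`, `q ^ h + y * q ^ (h - 1)` and
off-diagonal coefficients `y * q ^ (2 * (h - 1))`, along with their partial analogues. -/
def motzkinSum (x y q : R) : ℕ → ℕ → R
  | 0, 0 => 1
  | 0, _ + 1 => 0
  | t + 1, 0 => x * motzkinSum x y q t 0 + y * motzkinSum x y q t 1
  | t + 1, h + 1 => motzkinSum x y q t h +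
      (q ^ (h + 1) + y * q ^ h) * motzkinSum x y q t (h + 1) +
      y * q ^ (2 * h + 2) * motzkinSum x y q t (h + 2)

/-- The weight of a point of the graph of a `321`-avoiding permutation. -/
def weight321 (x y q : R) (j w : ℕ) : R :=
  if j < w then y * q ^ (w - j - 1) else if j = w then x else 1

theorem sum321_zero (φ : ℕ → ℕ → R) : sum321 φ 0 0 0 = 1 := by
  classical
  rw [sum321, Finset.filter_true_of_mem]
  · simp
  · intro σ _
    exact ⟨fun i => i.elim0, fun i => i.elim0⟩

theorem sum321_self (φ : ℕ → ℕ → R) (h : ℕ) : sum321 φ (h + 1) (h + 1) (h + 1) = 0 := by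
  classical
  rw [sum321, Finset.filter_false_of_mem, Finset.sum_empty]
  rintro σ _ ⟨-, h2⟩
  have := h2 0
  omega

theorem sum321_corner_zero (φ : ℕ → ℕ → R) (N p : ℕ) : sum321 φ N 0 p = sum321 φ N 0 0 := by
  classical
  rw [sum321, sum321]
  congr 1
  ext σ
  simp [Corner321]

variable (x y q : R)

theorem sum321_succ_zero (t : ℕ) : sum321 (weight321 x y q) (t + 1) 0 0 =
    sum321 (weight321 x y q) (t + 1) 1 1 + x * sum321 (weight321 x y q) t 0 0 := by
  -- A corner with no columns is empty whatever its number of rows, so one row may be added in order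
  -- to peel.
  rw [← sum321_corner_zero _ _ 1, sum321_peel_column _ (by simp) (by simp) (by simp)]
  congr 1
  congr 1
  · simp [weight321]
  · refine sum321_congr fun j w hj _ _ => ?_
    rw [shiftColumn, if_neg (by omega)]

/-- One row peeling followed by a column peeling of both resulting terms. The four outcomes are no
removal, one removal of either kind, and both removals. -/
theorem sum321_succ_succ (t h : ℕ) :
    sum321 (weight321 x y q) (t + h + 2) (h + 1) (h + 1) =
      sum321 (weight321 x y q) (t + h + 2) (h + 2) (h + 2) +
      (q ^ (h + 1) + y * q ^ h) * sum321 (weight321 x y q) (t + h + 1) (h + 1) (h + 1) +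
      y * q ^ (2 * h) * sum321 (weight321 x y q) (t + h) h h := by
  set φ := weight321 x y q with hφ
  -- The shifted columns avoid the top rows, so their points are below the diagonal before and after
  -- the shift, with weight 1.
  have e1 : sum321 (shiftColumn (t + h + 1 - (h + 1)) φ) (t + h + 1) (h + 1) (h + 1) =
      sum321 φ (t + h + 1) (h + 1) (h + 1) := by
    refine sum321_congr fun j w hj hw h3 => ?_
    rw [shiftColumn]
    split_ifs with h4
    · simp only [hφ, weight321]
      rw [if_neg (by omega), if_neg (by omega), if_neg (by omega), if_neg (by omega)]
    · rfl
  set ψ : ℕ → ℕ → R :=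
    fun j w => shiftColumn (t + h + 1 - (h + 1)) (fun a b => φ b a) w j with hψ
  -- Restoring the removed row raises the points of the top `h + 1` rows by one. They lie above the
  -- diagonal, so each gains a factor `q`.
  have e2 : sum321 ψ (t + h + 1) (h + 1) (h + 1) =
      q ^ (h + 1) * sum321 φ (t + h + 1) (h + 1) (h + 1) := by
    rw [← sum321_mul_top φ q (h + 1) (by omega)]
    refine sum321_congr fun j w hj hw h3 => ?_
    simp only [hψ, shiftColumn, hφ, weight321]
    by_cases h4 : t ≤ w
    · rw [if_pos (by omega), if_pos (by omega), if_pos (by omega), if_pos (by omega),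
        show w + 1 - j - 1 = (w - j - 1) + 1 by omega, pow_succ]
      ring
    · rw [if_neg (by omega), if_neg (c := t + h + 1 ≤ w + (h + 1)) (by omega), one_mul]
  have e3 : sum321 (shiftColumn (t + h - h) ψ) (t + h) h h =
      q ^ h * sum321 φ (t + h) h h := by
    rw [← sum321_mul_top φ q h (by omega)]
    refine sum321_congr fun j w hj hw h3 => ?_
    simp only [hψ, shiftColumn, hφ, weight321]
    by_cases h4 : t ≤ w
    · rw [if_neg (by omega), if_pos (by omega), if_pos (by omega), if_pos (by omega),
        if_pos (by omega), show w + 1 - j - 1 = (w - j - 1) + 1 by omega, pow_succ]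
      ring
    · rw [if_neg (c := t + h ≤ w + h) (by omega), one_mul]
      split_ifs <;> first | rfl | omega
  rw [sum321_peel_row φ (N := t + h + 1) (by simp) (by simp) (by omega),
    sum321_peel_column φ (N := t + h + 1) (by simp) (by simp) (by omega),
    sum321_peel_column ψ (N := t + h) (by simp) (by simp +contextual) (by omega), e1, e2, e3]
  have e4 : φ (t + h + 1 - (h + 1)) (t + h + 1) = y * q ^ h := by
    simp only [hφ, weight321]
    rw [if_pos (by omega)]
    congr 2
    omega
  have e5 : φ (t + h + 1) (t + h + 1 - (h + 1)) = 1 := by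
    simp only [hφ, weight321]
    rw [if_neg (by omega), if_neg (by omega)]
  have e6 : ψ (t + h - h) (t + h) = y * q ^ h := by
    simp only [hψ, shiftColumn, hφ, weight321]
    rw [if_pos (by omega), if_pos (by omega)]
    congr 2
    omega
  rw [e4, e5, e6]
  ring

theorem sum321_eq_motzkinSum (t : ℕ) : ∀ h, sum321 (weight321 x y q) (t + h) h h =
    y ^ h * q ^ (h * (h - 1)) * motzkinSum x y q t h := by
  induction t with
  | zero =>
    intro h
    cases h with
    | zero => simp [sum321_zero, motzkinSum]
    | succ h => simp [sum321_self, motzkinSum]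
  | succ t ih =>
    intro h
    cases h with
    | zero =>
      have h1 := ih 1
      have h0 := ih 0
      simp only [add_zero, pow_zero, zero_mul, one_mul, Nat.sub_self, mul_zero, pow_one, mul_one]
        at h0 h1 ⊢
      rw [sum321_succ_zero, h0, h1, motzkinSum]
      ring
    | succ h =>
      have h0 := ih h
      have h1 := ih (h + 1)
      have h2 := ih (h + 2)
      rw [show t + 1 + (h + 1) = t + h + 2 by ring, sum321_succ_succ, h0,
        show t + h + 1 = t + (h + 1) by ring, h1, show t + h + 2 = t + (h + 2) by ring, h2,
        motzkinSum]
      cases h with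
      | zero => simp; ring
      | succ h =>
        simp only [Nat.add_sub_cancel, show h + 1 + 2 - 1 = h + 2 by omega]
        ring

end Avoids321

theorem val_zero_succAbove {n : ℕ} (i : Fin n) : ((0 : Fin (n + 1)).succAbove i : ℕ) = i + 1 := by
  simp

/-! ### The recursion for 132-avoiding permutations -/

section Avoids132

/-- `σ` has no subsequence ordered like `132`. -/
def Avoids132 {n : ℕ} (σ : Equiv.Perm (Fin n)) : Prop :=
  ∀ i j k, i < j → j < k → σ i < σ k → σ k < σ j → False

theorem Avoids132.inverse {n : ℕ} {σ : Equiv.Perm (Fin n)} (h : Avoids132 σ) :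
    Avoids132 σ⁻¹ := by
  intro i j k hij hjk h1 h2
  exact h (σ⁻¹ i) (σ⁻¹ k) (σ⁻¹ j) h1 h2 (by simpa using hij) (by simpa using hjk)

theorem not_contains_p132_iff {n : ℕ} {σ : Equiv.Perm (Fin n)} :
    ¬ Contains σ p132 ↔ Avoids132 σ := by
  constructor
  · intro h i j k hij hjk h1 h2
    refine h ⟨![i, j, k], ?_, ?_⟩
    · rw [Fin.strictMono_iff_lt_succ]
      intro a
      fin_cases a <;> simpa
    · have h3 := h1.trans h2
      intro a b
      fin_cases a <;> fin_cases b <;> simp [p132, h1, h2, h3, h1.le, h2.le, h3.le]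
  · rintro h ⟨f, hf, hp⟩
    exact h (f 0) (f 1) (f 2) (hf (by decide)) (hf (by decide)) ((hp 0 2).2 (by decide))
      ((hp 2 1).2 (by decide))

/-- The number of points of the graph of `σ` to the lower left of the point in column `j`. -/
def lowerLeft {n : ℕ} (σ : Equiv.Perm (Fin n)) (j : Fin n) : ℕ :=
  #{i : Fin n | i < j ∧ σ i < σ j}

theorem lowerLeft_inverse {n : ℕ} (σ : Equiv.Perm (Fin n)) (j : Fin n) :
    lowerLeft σ⁻¹ (σ j) = lowerLeft σ j := by
  refine (Finset.card_equiv σ fun i => ?_).symm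
  simp [and_comm]

theorem lowerLeft_insertPoint_succAbove {n : ℕ} (p v : Fin (n + 1)) (σ : Equiv.Perm (Fin n))
    (j : Fin n) : lowerLeft (insertPoint p v σ) (p.succAbove j) =
      lowerLeft σ j + if p < p.succAbove j ∧ v < v.succAbove (σ j) then 1 else 0 := by
  rw [lowerLeft, lowerLeft, Finset.card_filter, Finset.card_filter, Fin.sum_univ_succAbove _ p]
  simp [add_comm]

/-- The `132`-avoiding permutations of length `N` whose graph has no point in the first column
in the top `a - 1` rows, no point in the bottom row in the last `b - 1` columns, and no point both
in the last `b` columns and in the top `a` rows. -/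
structure Corner132 (N a b : ℕ) (σ : Equiv.Perm (Fin N)) : Prop where
  avoids : Avoids132 σ
  add_le : a + b ≤ N
  first_column : ∀ i : Fin N, (i : ℕ) = 0 → (σ i : ℕ) + a ≤ N
  bottom_row : ∀ i : Fin N, (σ i : ℕ) = 0 → (i : ℕ) + b ≤ N
  corner : ∀ i : Fin N, (i : ℕ) + b < N ∨ (σ i : ℕ) + a < N

theorem Corner132.inverse {N a b : ℕ} {σ : Equiv.Perm (Fin N)} (h : Corner132 N a b σ) :
    Corner132 N b a σ⁻¹ where
  avoids := h.avoids.inverse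
  add_le := by rw [add_comm]; exact h.add_le
  first_column i hi := h.bottom_row _ (by simpa using hi)
  bottom_row i hi := by simpa using h.first_column _ hi
  corner i := by simpa [or_comm] using h.corner (σ⁻¹ i)

theorem corner132_inverse_iff {N a b : ℕ} {σ : Equiv.Perm (Fin N)} :
    Corner132 N b a σ⁻¹ ↔ Corner132 N a b σ :=
  ⟨fun h => by simpa using h.inverse, Corner132.inverse⟩

/-- Otherwise the point of the first column, which is no higher than row `N - a`, would be the 1 of
a 132 with the two points in question. -/
theorem Avoids132.top_increasing {N a : ℕ} {σ : Equiv.Perm (Fin N)} (hσ : Avoids132 σ)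
    (h0 : ∀ i : Fin N, (i : ℕ) = 0 → (σ i : ℕ) + a ≤ N) {i j : Fin N} (hi : N ≤ σ i + a)
    (hij : σ i < σ j) : i < j := by
  by_contra h
  have hne : i ≠ j := fun h => hij.ne (congrArg σ h)
  have hji : j < i := lt_of_le_of_ne (not_lt.1 h) hne.symm
  let z : Fin N := ⟨0, i.pos⟩
  have hz := h0 z rfl
  have hzi : σ z ≤ σ i := by rw [Fin.le_def]; omega
  rcases hzi.eq_or_lt with h1 | h1
  · have := σ.injective h1
    rw [← this] at hji
    exact absurd hji (by simp [z, Fin.lt_def])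
  · have hzj : z < j := by
      rw [Fin.lt_def]
      simp only [z]
      rcases Nat.eq_zero_or_pos (j : ℕ) with h2 | h2
      · have : z = j := Fin.ext h2.symm
        rw [this] at h1
        exact absurd h1 hij.asymm
      · exact h2
    exact hσ z j i hzj hji h1 hij

/-- The top `a` rows are increasing and stay left of the last `b` columns, so each row further down
costs at least one column. Thus a point of these rows satisfies `j + b ≤ σ j`, which settles its
side of the shifted diagonals used later. -/
theorem Avoids132.position_bound {N a b : ℕ} {σ : Equiv.Perm (Fin N)} (hσ : Avoids132 σ)
    (h0 : ∀ i : Fin N, (i : ℕ) = 0 → (σ i : ℕ) + a ≤ N)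
    (hc : ∀ i : Fin N, (i : ℕ) + b < N ∨ (σ i : ℕ) + a < N) (j : Fin N) (hj : N ≤ σ j + a) :
    (j : ℕ) + (N - 1 - σ j) + b < N := by
  obtain ⟨k, hk⟩ : ∃ k, N - 1 - (σ j : ℕ) = k := ⟨_, rfl⟩
  rw [hk]
  induction k generalizing j with
  | zero =>
    have := hc j
    omega
  | succ k ih =>
    let j' : Fin N := σ⁻¹ ⟨σ j + 1, by omega⟩
    have hj' : (σ j' : ℕ) = σ j + 1 := by simp [j']
    have h1 : j < j' := hσ.top_increasing h0 hj (by rw [Fin.lt_def]; omega)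
    have := ih j' (by omega) (by omega)
    rw [Fin.lt_def] at h1
    omega

theorem Avoids132.row_bound {N a b : ℕ} {σ : Equiv.Perm (Fin N)} (hσ : Avoids132 σ)
    (h0 : ∀ i : Fin N, (σ i : ℕ) = 0 → (i : ℕ) + b ≤ N)
    (hc : ∀ i : Fin N, (i : ℕ) + b < N ∨ (σ i : ℕ) + a < N) (j : Fin N) (hj : N ≤ j + b) :
    (σ j : ℕ) + (N - 1 - j) + a < N := by
  have := hσ.inverse.position_bound (a := b) (b := a) (fun i hi => h0 _ (by simpa using hi))
    (fun i => by simpa [or_comm] using hc (σ⁻¹ i)) (σ j)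
  rw [show σ⁻¹ (σ j) = j by simp] at this
  exact this hj

/-- On a nonempty board `a + b ≤ N + 1` is automatic: apply `row_bound` to the leftmost of the last
`b` columns. -/
theorem Corner132.of_succ {N a b : ℕ} {σ : Equiv.Perm (Fin (N + 1))} (hσ : Avoids132 σ)
    (h0 : (σ 0 : ℕ) + a ≤ N + 1) (h0' : ∀ i : Fin (N + 1), (σ i : ℕ) = 0 → (i : ℕ) + b ≤ N + 1)
    (hc : ∀ i : Fin (N + 1), (i : ℕ) + b < N + 1 ∨ (σ i : ℕ) + a < N + 1) :
    Corner132 (N + 1) a b σ where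
  avoids := hσ
  first_column i hi := by
    obtain rfl : i = 0 := Fin.ext hi
    exact h0
  bottom_row := h0'
  corner := hc
  add_le := by
    rcases Nat.eq_zero_or_pos b with rfl | hb
    · omega
    · have h1 := h0' (σ⁻¹ 0) (by simp)
      have := hσ.row_bound h0' hc ⟨N + 1 - b, by omega⟩ (by simp; omega)
      simp only at this
      omega

/-- A first point in row `N - a` is not the 1 of a 132 exactly when the `a` rows above it are
increasing. For a remainder avoiding 132 this is the first-column condition. -/
theorem corner132_insertPoint_first_iff {N a b : ℕ} (σ : Equiv.Perm (Fin N)) :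
    Corner132 (N + 1) (a + 1) b (insertPoint 0 ⟨N - a, by omega⟩ σ) ↔ Corner132 N a b σ := by
  set v : Fin (N + 1) := ⟨N - a, by omega⟩ with hv
  have hvv : (v : ℕ) = N - a := rfl
  constructor
  · intro h
    have hs := h.add_le
    refine ⟨fun i j k hij hjk h3 h4 => ?_, by omega, fun i hi => ?_, fun i hi => ?_, fun i => ?_⟩
    · refine h.avoids (Fin.succAbove 0 i) (Fin.succAbove 0 j) (Fin.succAbove 0 k) ?_ ?_ ?_ ?_ <;>
        simp only [insertPoint_apply_succAbove, Fin.succAbove_lt_succAbove_iff] <;> assumption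
    · by_contra hlt
      let t : Fin N := σ⁻¹ ⟨N - a, by omega⟩
      have ht : (σ t : ℕ) = N - a := by simp [t]
      have hti : i < t := by
        rw [Fin.lt_def]
        have : (t : ℕ) ≠ i := fun h => by
          have := Fin.ext h
          rw [this] at ht
          omega
        omega
      refine h.avoids 0 (Fin.succAbove 0 i) (Fin.succAbove 0 t) (by simp) (by simpa) ?_ ?_
      · rw [insertPoint_apply_self, insertPoint_apply_succAbove, Fin.lt_def, val_succAbove]
        split_ifs <;> omega
      · rw [insertPoint_apply_succAbove, insertPoint_apply_succAbove,
          Fin.succAbove_lt_succAbove_iff, Fin.lt_def]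
        omega
    · have := h.bottom_row (Fin.succAbove 0 i)
      rw [insertPoint_apply_succAbove, val_succAbove, val_zero_succAbove, hi] at this
      split_ifs at this <;> omega
    · have := h.corner (Fin.succAbove 0 i)
      rw [insertPoint_apply_succAbove, val_zero_succAbove, val_succAbove] at this
      split_ifs at this <;> omega
  · intro h
    have hs := h.add_le
    refine ⟨fun i j k hij hjk h3 h4 => ?_, by omega, fun i hi => ?_, fun i hi => ?_, fun i => ?_⟩
    · rcases Fin.eq_self_or_eq_succAbove 0 k with rfl | ⟨k, rfl⟩
      · exact absurd hjk (Fin.zero_le _).not_gt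
      rcases Fin.eq_self_or_eq_succAbove 0 j with rfl | ⟨j, rfl⟩
      · exact absurd hij (Fin.zero_le _).not_gt
      rcases Fin.eq_self_or_eq_succAbove 0 i with rfl | ⟨i, rfl⟩
      · simp only [insertPoint_apply_succAbove, insertPoint_apply_self,
          Fin.succAbove_lt_succAbove_iff] at h3 h4 hjk
        rw [Fin.lt_def, val_succAbove] at h3
        have hk : N ≤ σ k + a := by split_ifs at h3 <;> omega
        exact absurd (h.avoids.top_increasing h.first_column hk h4) hjk.asymm
      · simp only [insertPoint_apply_succAbove, Fin.succAbove_lt_succAbove_iff] at *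
        exact h.avoids i j k hij hjk h3 h4
    · obtain rfl : i = 0 := Fin.ext hi
      rw [insertPoint_apply_self]
      omega
    · rcases Fin.eq_self_or_eq_succAbove 0 i with rfl | ⟨i, rfl⟩
      · simp only [Fin.val_zero]
        omega
      · have := h.bottom_row i
        rw [insertPoint_apply_succAbove, val_succAbove] at hi
        rw [val_zero_succAbove]
        split_ifs at hi
        omega
    · rcases Fin.eq_self_or_eq_succAbove 0 i with rfl | ⟨i, rfl⟩
      · left
        simp only [Fin.val_zero]
        omega
      · have := h.corner i
        rw [insertPoint_apply_succAbove, val_zero_succAbove, val_succAbove]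
        split_ifs <;> omega

/-- If the first point is lower than row `N - a`, a point of the last `b` columns in row `N - a - 1`
would form a 132 with the first point and the maximum, which lies left of these columns. -/
theorem corner132_succ_iff {N a b : ℕ} (σ : Equiv.Perm (Fin (N + 1))) :
    (Corner132 (N + 1) (a + 1) b σ ∧ σ 0 ≠ ⟨N - a, by omega⟩) ↔
      Corner132 (N + 1) (a + 2) b σ := by
  constructor
  · rintro ⟨h, hne⟩
    have hs := h.add_le
    have h0 := h.first_column 0 rfl
    have hne' : (σ 0 : ℕ) ≠ N - a := fun h => hne (Fin.ext h)
    refine Corner132.of_succ h.avoids (by omega) h.bottom_row fun i => ?_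
    by_contra hi
    have hci := h.corner i
    have hi0 : i ≠ 0 := by
      rintro rfl
      simp only [Fin.val_zero] at *
      omega
    have h0i : σ 0 < σ i := by
      refine lt_of_le_of_ne ?_ fun h => hi0 (σ.injective h).symm
      rw [Fin.le_def]
      omega
    let t : Fin (N + 1) := σ⁻¹ (Fin.last N)
    have ht : σ t = Fin.last N := by simp [t]
    have hct := h.corner t
    rw [ht, Fin.val_last] at hct
    refine h.avoids 0 t i ?_ ?_ h0i ?_
    · refine lt_of_le_of_ne (Fin.zero_le _) ?_
      rintro h1
      rw [← h1] at ht
      rw [ht, Fin.val_last] at h0 hne'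
      omega
    · rw [Fin.lt_def]
      omega
    · rw [ht, Fin.lt_def, Fin.val_last]
      omega
  · intro h
    have hs := h.add_le
    have h0 := h.first_column 0 rfl
    refine ⟨Corner132.of_succ h.avoids (by omega) h.bottom_row fun i => ?_, fun h1 => ?_⟩
    · have := h.corner i
      omega
    · rw [h1] at h0
      simp only at h0
      omega

theorem corner132_insertPoint_last_iff {N b : ℕ} (σ : Equiv.Perm (Fin N)) :
    Corner132 (N + 1) 0 (b + 1) (insertPoint (Fin.last N) (Fin.last N) σ) ↔
      Corner132 N 0 b σ := by
  constructor
  · intro h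
    have hs := h.add_le
    refine ⟨fun i j k hij hjk h3 h4 => ?_, by omega, fun i hi => by omega, fun i hi => ?_,
      fun i => Or.inr (by omega)⟩
    · refine h.avoids (Fin.succAbove (Fin.last N) i) (Fin.succAbove (Fin.last N) j)
        (Fin.succAbove (Fin.last N) k) ?_ ?_ ?_ ?_ <;>
        simp only [insertPoint_apply_succAbove, Fin.succAbove_lt_succAbove_iff] <;> assumption
    · have := h.bottom_row (Fin.succAbove (Fin.last N) i)
      rw [insertPoint_apply_succAbove] at this
      simp only [Fin.succAbove_last, Fin.val_castSucc] at this
      have := this hi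
      omega
  · intro h
    have hs := h.add_le
    refine ⟨fun i j k hij hjk h3 h4 => ?_, by omega, fun i hi => by omega, fun i hi => ?_,
      fun i => Or.inr (by omega)⟩
    · rcases Fin.eq_self_or_eq_succAbove (Fin.last N) k with rfl | ⟨k, rfl⟩
      · rw [insertPoint_apply_self] at h4
        exact absurd h4 (Fin.le_last _).not_gt
      rcases Fin.eq_self_or_eq_succAbove (Fin.last N) j with rfl | ⟨j, rfl⟩
      · exact absurd hjk (Fin.le_last _).not_gt
      rcases Fin.eq_self_or_eq_succAbove (Fin.last N) i with rfl | ⟨i, rfl⟩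
      · exact absurd hij (Fin.le_last _).not_gt
      simp only [insertPoint_apply_succAbove, Fin.succAbove_lt_succAbove_iff] at *
      exact h.avoids i j k hij hjk h3 h4
    · rcases Fin.eq_self_or_eq_succAbove (Fin.last N) i with rfl | ⟨i, rfl⟩
      · rw [insertPoint_apply_self] at hi
        simp only [Fin.val_last] at *
        omega
      · have := h.bottom_row i
        rw [insertPoint_apply_succAbove] at hi
        simp only [Fin.succAbove_last, Fin.val_castSucc] at *
        have := this hi
        omega

/-- The bottom-row condition makes the last `b + 1` columns increasing, so the maximum can lie among
them only in the last one. -/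
theorem corner132_succ_zero_iff {N b : ℕ} (σ : Equiv.Perm (Fin (N + 1))) :
    (Corner132 (N + 1) 0 (b + 1) σ ∧ σ (Fin.last N) ≠ Fin.last N) ↔
      Corner132 (N + 1) 1 (b + 1) σ := by
  constructor
  · rintro ⟨h, hne⟩
    refine Corner132.of_succ h.avoids (by omega) h.bottom_row fun i => ?_
    by_contra hi
    have hil : i < Fin.last N := by
      refine lt_of_le_of_ne (Fin.le_last _) ?_
      rintro rfl
      exact hne (Fin.ext (by rw [Fin.val_last]; omega))
    have hinv := h.inverse
    have := hinv.avoids.top_increasing hinv.first_column (i := σ i) (j := σ (Fin.last N))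
      (by rw [show σ⁻¹ (σ i) = i by simp]; omega) (by simpa using hil)
    rw [Fin.lt_def] at this
    omega
  · intro h
    refine ⟨Corner132.of_succ h.avoids (by omega) h.bottom_row fun i => Or.inr (by omega),
      fun h1 => ?_⟩
    have := h.corner (Fin.last N)
    rw [h1, Fin.val_last] at this
    omega

variable {R : Type*} [CommSemiring R]

open Classical in
/-- Sum over `Corner132 N a b` of the products of the weights `φ j (σ j) (lowerLeft σ j)`. -/
noncomputable def sum132 (φ : ℕ → ℕ → ℕ → R) (N a b : ℕ) : R :=
  ∑ σ : Equiv.Perm (Fin N) with Corner132 N a b σ, ∏ j : Fin N, φ j (σ j) (lowerLeft σ j)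

theorem sum132_transpose (φ : ℕ → ℕ → ℕ → R) (N a b : ℕ) :
    sum132 (fun j w m => φ w j m) N b a = sum132 φ N a b := by
  classical
  refine (Finset.sum_equiv (Equiv.inv (Equiv.Perm (Fin N))) (fun σ => ?_) (fun σ _ => ?_)).symm
  · simp [corner132_inverse_iff]
  · exact Fintype.prod_equiv σ _ _ (by simp [lowerLeft_inverse])

theorem sum132_congr {φ ψ : ℕ → ℕ → ℕ → R} {N a b : ℕ}
    (h : ∀ j w m, j < N → w < N → a + b ≤ N → (N ≤ w + a → j + (N - 1 - w) + b < N) →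
      (N ≤ j + b → w + (N - 1 - j) + a < N) → φ j w m = ψ j w m) :
    sum132 φ N a b = sum132 ψ N a b := by
  classical
  refine Finset.sum_congr rfl fun σ hσ => Finset.prod_congr rfl fun j _ => ?_
  have hσ := (mem_filter.1 hσ).2
  exact h _ _ _ j.2 (σ j).2 hσ.add_le
    (hσ.avoids.position_bound hσ.first_column hσ.corner j)
    (hσ.avoids.row_bound hσ.bottom_row hσ.corner j)

theorem sum132_eq_zero (φ : ℕ → ℕ → ℕ → R) {N a b : ℕ} (h : N < a + b) :
    sum132 φ N a b = 0 := by
  classical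
  rw [sum132, Finset.filter_false_of_mem, Finset.sum_empty]
  intro σ _ hσ
  exact absurd hσ.add_le h.not_ge

theorem sum132_mul_top (φ : ℕ → ℕ → ℕ → R) (q : R) (N a b : ℕ) :
    sum132 (fun j w m => (if N ≤ w + a then q else 1) * φ j w m) N a b =
      q ^ a * sum132 φ N a b := by
  classical
  by_cases h : a + b ≤ N
  · rw [sum132, sum132, Finset.mul_sum]
    refine Finset.sum_congr rfl fun σ _ => ?_
    rw [Finset.prod_mul_distrib, prod_ite_le_val_add (by omega)]
  · rw [sum132_eq_zero _ (by omega), sum132_eq_zero _ (by omega), mul_zero]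

theorem sum132_mul_right (φ : ℕ → ℕ → ℕ → R) (q : R) (N a b : ℕ) :
    sum132 (fun j w m => (if N ≤ j + b then q else 1) * φ j w m) N a b =
      q ^ b * sum132 φ N a b := by
  rw [← sum132_transpose, ← sum132_transpose φ]
  exact sum132_mul_top (fun j w m => φ w j m) q N b a

/-- The weight seen by the remaining points when the first column and row `c` are removed. -/
def shiftFirst (c : ℕ) (φ : ℕ → ℕ → ℕ → R) (j w m : ℕ) : R :=
  if c ≤ w then φ (j + 1) (w + 1) (m + 1) else φ (j + 1) w m

theorem sum132_peel_left (φ : ℕ → ℕ → ℕ → R) (N a b : ℕ) :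
    sum132 φ (N + 1) (a + 1) b = sum132 φ (N + 1) (a + 2) b +
      φ 0 (N - a) 0 * sum132 (shiftFirst (N - a) φ) N a b := by
  classical
  rw [sum132, ← Finset.sum_filter_add_sum_filter_not _
    (fun σ => σ 0 = ⟨N - a, by omega⟩), Finset.filter_filter, Finset.filter_filter,
    add_comm]
  congr 1
  · rw [sum132]
    congr 1
    ext σ
    simp only [mem_filter, mem_univ, true_and]
    exact corner132_succ_iff σ
  · rw [sum_filter_apply_eq, sum132, Finset.mul_sum]
    refine Finset.sum_congr ?_ fun σ _ => ?_
    · ext σ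
      simp only [mem_filter, mem_univ, true_and]
      exact corner132_insertPoint_first_iff σ
    · rw [Fin.prod_univ_succAbove _ (0 : Fin (N + 1))]
      congr 1
      · simp [lowerLeft]
      · refine Finset.prod_congr rfl fun j _ => ?_
        rw [lowerLeft_insertPoint_succAbove, insertPoint_apply_succAbove, shiftFirst]
        simp only [Fin.lt_def, val_succAbove (⟨N - a, _⟩ : Fin (N + 1)), val_zero_succAbove,
          Fin.val_zero]
        split_ifs <;> first | rfl | omega

theorem sum132_peel_right (φ : ℕ → ℕ → ℕ → R) (N a b : ℕ) :
    sum132 φ (N + 1) a (b + 1) = sum132 φ (N + 1) a (b + 2) +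
      φ (N - b) 0 0 * sum132 (fun j w m => shiftFirst (N - b) (fun u v k => φ v u k) w j m) N a b
        := by
  rw [← sum132_transpose φ, ← sum132_transpose φ, sum132_peel_left]
  congr 2
  exact sum132_transpose
    (fun j w m => shiftFirst (N - b) (fun u v k => φ v u k) w j m) N a b

theorem sum132_peel_last (φ : ℕ → ℕ → ℕ → R) (N b : ℕ) :
    sum132 φ (N + 1) 0 (b + 1) = sum132 φ (N + 1) 1 (b + 1) + φ N N N * sum132 φ N 0 b := by
  classical
  rw [sum132, ← Finset.sum_filter_add_sum_filter_not _
    (fun σ => σ (Fin.last N) = Fin.last N), Finset.filter_filter, Finset.filter_filter,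
    add_comm]
  congr 1
  · rw [sum132]
    congr 1
    ext σ
    simp only [mem_filter, mem_univ, true_and]
    exact corner132_succ_zero_iff σ
  · rw [sum_filter_apply_eq, sum132, Finset.mul_sum]
    refine Finset.sum_congr ?_ fun σ _ => ?_
    · ext σ
      simp only [mem_filter, mem_univ, true_and]
      exact corner132_insertPoint_last_iff σ
    · rw [Fin.prod_univ_succAbove _ (Fin.last N)]
      congr 1
      · have : lowerLeft (insertPoint (Fin.last N) (Fin.last N) σ) (Fin.last N) = N := by
          rw [lowerLeft, Finset.card_filter, Fin.sum_univ_succAbove _ (Fin.last N)]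
          simp only [insertPoint_apply_succAbove, insertPoint_apply_self]
          simp [Fin.castSucc_lt_last]
        rw [this]
        simp
      · refine Finset.prod_congr rfl fun j _ => ?_
        rw [lowerLeft_insertPoint_succAbove, insertPoint_apply_succAbove]
        rw [if_neg fun h => absurd h.1 (Fin.le_last _).not_gt, add_zero, Fin.succAbove_last,
          Fin.val_castSucc, Fin.val_castSucc]

theorem sum132_peel_last' (φ : ℕ → ℕ → ℕ → R) (N a : ℕ) :
    sum132 φ (N + 1) (a + 1) 0 = sum132 φ (N + 1) (a + 1) 1 + φ N N N * sum132 φ N a 0 := by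
  rw [← sum132_transpose φ, ← sum132_transpose φ, ← sum132_transpose φ, sum132_peel_last]

theorem sum132_zero_one (φ : ℕ → ℕ → ℕ → R) (N : ℕ) :
    sum132 φ (N + 1) 0 1 = sum132 φ (N + 1) 0 0 := by
  classical
  rw [sum132, sum132]
  congr 1
  ext σ
  simp only [mem_filter, mem_univ, true_and]
  constructor
  · intro h
    exact Corner132.of_succ h.avoids (by omega) (fun i _ => by omega) fun i => by omega
  · intro h
    exact Corner132.of_succ h.avoids (by omega) (fun i _ => by omega) fun i => by omega

theorem sum132_zero (φ : ℕ → ℕ → ℕ → R) : sum132 φ 0 0 0 = 1 := by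
  classical
  rw [sum132, Finset.filter_true_of_mem]
  · simp
  · intro σ _
    exact ⟨fun i => i.elim0, le_rfl, fun i => i.elim0, fun i => i.elim0, fun i => i.elim0⟩

end Avoids132

/-! ### Shifted diagonals and evaluation of the 132 sums -/

section Weight132

variable {R : Type*} [CommSemiring R]

/-- The weight of a point of the graph of a `132`-avoiding permutation with respect to the
diagonal shifted by `s`. -/
def weight132 (x y q : R) (s : ℤ) (j w m : ℕ) : R :=
  if (j : ℤ) + s < w then y * q ^ min m (w - j - s - 1).toNat
  else if (j : ℤ) + s = w then x else q ^ min m (j + s - w).toNat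

theorem weight132_of_lt (x y q : R) {s : ℤ} {j w : ℕ} (m d : ℕ) (h : (w : ℤ) = j + s + 1 + d) :
    weight132 x y q s j w m = y * q ^ min m d := by
  rw [weight132, if_pos (by omega), show (w - j - s - 1 : ℤ).toNat = d by omega]

theorem weight132_of_gt (x y q : R) {s : ℤ} {j w : ℕ} (m d : ℕ) (hd : d ≠ 0)
    (h : (j : ℤ) + s = w + d) :
    weight132 x y q s j w m = q ^ min m d := by
  rw [weight132, if_neg (by omega), if_neg (by omega), show (j + s - w : ℤ).toNat = d by omega]

theorem weight132_one_of_ge (y q : R) {s : ℤ} {j w : ℕ} (m d : ℕ)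
    (h : (j : ℤ) + s = w + d) :
    weight132 1 y q s j w m = q ^ min m d := by
  rcases Nat.eq_zero_or_pos d with rfl | hd
  · rw [weight132, if_neg (by omega), if_pos (by omega)]
    simp
  · exact weight132_of_gt 1 y q m d hd.ne' h

theorem weight132_of_ne (x x' y q : R) {s : ℤ} {j w : ℕ} (m : ℕ)
    (h : (j : ℤ) + s ≠ w) :
    weight132 x y q s j w m = weight132 x' y q s j w m := by
  rw [weight132, weight132, if_neg h, if_neg h]

theorem weight132_congr (x y q : R) {s s' : ℤ} {j j' w w' : ℕ} (m : ℕ)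
    (h : (w : ℤ) - j - s = w' - j' - s') :
    weight132 x y q s j w m = weight132 x y q s' j' w' m := by
  have h1 : (j : ℤ) + s < w ↔ (j' : ℤ) + s' < w' := by omega
  have h2 : (j : ℤ) + s = w ↔ (j' : ℤ) + s' = w' := by omega
  rw [weight132, weight132, h, show (j : ℤ) + s - w = j' + s' - w' by omega]
  simp only [h1, h2]

/-- Variant of `weight132` that ignores `x` in the last `b` of `N` columns. -/
def weight132' (x y q : R) (s : ℤ) (N b : ℕ) (j w m : ℕ) : R :=
  weight132 (if N ≤ j + b then 1 else x) y q s j w m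

variable (x y q : R)

/-- When `2 * s = b - a - 1`, `row_bound` keeps the last `b` columns off the diagonal unless `a = 0`
and `b = 1`. Only there does dropping `x` change the sum. -/
theorem weight132'_eq {s : ℤ} {N b j w : ℕ} (m : ℕ) (h : N ≤ j + b → (j : ℤ) + s ≠ w) :
    weight132' x y q s N b j w m = weight132 x y q s j w m := by
  rw [weight132']
  split_ifs with h1
  · exact weight132_of_ne _ _ _ _ _ (h h1)
  · rfl

theorem sum132'_succ {N a b : ℕ} {s : ℤ} (hs : 2 * s = b - (a + 1) - 1) :
    sum132 (weight132' x y q s (N + 1) b) (N + 1) (a + 1) b =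
      sum132 (weight132 x y q s) (N + 1) (a + 2) b +
      y * q ^ a * sum132 (weight132 x y q (s + 1)) N a b := by
  rw [sum132_peel_left]
  congr 1
  · refine sum132_congr fun j w m hj hw hab h1 h2 => weight132'_eq _ _ _ _ fun h3 => ?_
    have := h2 h3
    omega
  · by_cases hab : a + b ≤ N
    · rw [mul_assoc]
      congr 1
      · rw [weight132'_eq _ _ _ _ (by omega), weight132_of_lt x y q 0 (N - a - s - 1).toNat
          (by omega)]
        simp
      -- Points below the removed row now see the diagonal shifted by `s + 1`. A point of the top
      -- `a` rows also loses a lower-left neighbour, so both arguments of its `min` drop by one and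
      -- a factor `q` comes out.
      · rw [← sum132_mul_top]
        refine sum132_congr fun j w m hj hw _ h1 h2 => ?_
        rw [shiftFirst]
        split_ifs with h3 h4 h4
        · have := h1 h4
          rw [weight132'_eq _ _ _ _ (by omega),
            weight132_of_lt x y q (m + 1) (w - j - s - 1).toNat (by omega),
            weight132_of_lt x y q m (w - j - s - 2).toNat (by omega),
            show (w - j - s - 1 : ℤ).toNat = (w - j - s - 2 : ℤ).toNat + 1 by omega,
            min_add_add_right, pow_succ]
          ring
        · omega
        · omega
        · rw [one_mul, weight132'_eq _ _ _ _ ?_]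
          · exact weight132_congr _ _ _ _ (by push_cast; ring)
          · intro h5
            have := h2 (by omega)
            omega
    · rw [sum132_eq_zero _ (by omega), sum132_eq_zero _ (by omega), mul_zero, mul_zero]

theorem sum132'_zero_succ {N b : ℕ} {s : ℕ} (hs : 2 * s = b) :
    sum132 (weight132' x y q s (N + 1) (b + 1)) (N + 1) 0 (b + 1) =
      sum132 (weight132 x y q s) (N + 1) 1 (b + 1) +
      q ^ s * sum132 (weight132 x y q s) N 0 b := by
  rw [sum132_peel_last]
  congr 1
  · refine sum132_congr fun j w m hj hw hab h1 h2 => weight132'_eq _ _ _ _ fun h3 => ?_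
    have := h2 h3
    omega
  · by_cases hab : 0 + b ≤ N
    · congr 1
      · rw [weight132', if_pos (by omega), weight132_one_of_ge y q N s (by omega),
          min_eq_right (by omega)]
      · refine sum132_congr fun j w m hj hw _ h1 h2 => weight132'_eq _ _ _ _ fun h3 => ?_
        have := h2 (by omega)
        omega
    · rw [sum132_eq_zero _ (by omega), sum132_eq_zero _ (by omega), mul_zero, mul_zero]

theorem sum132_succ {N a b : ℕ} {s : ℤ} (hs : 2 * s = b + 1 - a) (hab : 0 < a + b) :
    sum132 (weight132 x y q s) (N + 1) a (b + 1) =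
      sum132 (weight132' x y q s (N + 1) (b + 2)) (N + 1) a (b + 2) +
      q ^ b * sum132 (weight132' x y q (s - 1) N b) N a b := by
  rw [sum132_peel_right]
  congr 1
  · refine sum132_congr fun j w m hj hw _ h1 h2 => (weight132'_eq _ _ _ _ fun h3 => ?_).symm
    have := h2 h3
    omega
  · by_cases h : a + b ≤ N
    · rw [weight132_of_gt x y q 0 (N - b + s).toNat (by omega) (by omega), Nat.zero_min, pow_zero,
        one_mul, ← sum132_mul_right]
      refine sum132_congr fun j w m hj hw _ h1 h2 => ?_
      rw [shiftFirst]
      split_ifs with h3 h4 h4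
      · have := h2 h4
        -- A point of the last `b` columns was strictly below the old diagonal and may land on the
        -- new one. Its remaining weight is then 1 and not `x`, which is why `weight132'` appears.
        rw [weight132', if_pos h4, weight132_one_of_ge y q m (j + s - w - 1).toNat (by omega),
          weight132_of_gt x y q (m + 1) ((j + s - w - 1).toNat + 1) (by omega) (by omega),
          min_add_add_right, pow_succ]
        ring
      · omega
      · omega
      · rw [one_mul, weight132', if_neg h4]
        exact weight132_congr _ _ _ _ (by push_cast; ring)
    · rw [sum132_eq_zero _ (by omega), sum132_eq_zero (weight132' _ _ _ _ _ _) (by omega),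
        mul_zero, mul_zero]

theorem sum132_succ_zero {N a e : ℕ} {s : ℤ} (hs : 2 * s = -(a + 1)) (he : s = -(e + 1)) :
    sum132 (weight132 x y q s) (N + 1) (a + 1) 0 =
      sum132 (weight132' x y q s (N + 1) 1) (N + 1) (a + 1) 1 +
      y * q ^ e * sum132 (weight132' x y q s N 0) N a 0 := by
  rw [sum132_peel_last']
  congr 1
  · refine sum132_congr fun j w m hj hw _ h1 h2 => (weight132'_eq _ _ _ _ fun h3 => ?_).symm
    have := h2 h3
    omega
  · by_cases h : a + 0 ≤ N
    · congr 1
      · rw [weight132_of_lt x y q N e (by omega), min_eq_right (by omega)]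
      · exact sum132_congr fun j w m hj hw _ h1 h2 => (weight132'_eq _ _ _ _ (by omega)).symm
    · rw [sum132_eq_zero _ (by omega), sum132_eq_zero _ (by omega), mul_zero, mul_zero]

theorem sum132_succ_zero_zero (N : ℕ) :
    sum132 (weight132 x y q 0) (N + 1) 0 0 =
      sum132 (weight132 x y q 0) (N + 1) 1 1 + x * sum132 (weight132 x y q 0) N 0 0 := by
  rw [← sum132_zero_one, sum132_peel_last]
  congr 2
  simp [weight132]

/-- The triangular numbers, indexed by integers. -/
def triangle (d : ℤ) : ℕ := (d * (d - 1) / 2).toNat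

theorem two_mul_triangle (d : ℤ) : 2 * (triangle d : ℤ) = d * (d - 1) := by
  have h : 0 ≤ d * (d - 1) := by
    rcases le_or_gt d 0 with h | h
    · exact mul_nonneg_of_nonpos_of_nonpos h (by omega)
    · exact mul_nonneg h.le (by omega)
  obtain ⟨k, hk⟩ := Int.even_mul_pred_self d
  rw [triangle, Int.toNat_of_nonneg (by omega)]
  omega

theorem cast_mul_pred (h : ℕ) : ((h * (h - 1) : ℕ) : ℤ) = h * (h - 1) := by
  cases h <;> simp

/-- The first half of a Motzkin step. With `A h = M t h + y * q ^ h * M t (h + 1)`, where `M` is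
`motzkinSum`, the second half is `M (t + 1) (h + 1) = A h + q ^ (h + 1) * A (h + 1)`. The left side
is peeled if `a` is positive; for `a = 0` the last point is peeled instead. -/
theorem sum132'_of_sum132 {t : ℕ}
    (ih : ∀ (h a b : ℕ) (s : ℤ), a + b = 2 * h → 2 * s = b - a →
      sum132 (weight132 x y q s) (t + h) a b =
        y ^ a * q ^ (h * (h - 1) + triangle (a - h)) * motzkinSum x y q t h)
    (h a b : ℕ) (s : ℤ) (hab : a + b = 2 * h + 1) (hs : 2 * s = b - a - 1) :
    sum132 (weight132' x y q s (t + h + 1) b) (t + h + 1) a b =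
      y ^ a * q ^ (h * h + triangle (a - h)) *
        (motzkinSum x y q t h + y * q ^ h * motzkinSum x y q t (h + 1)) := by
  cases a with
  | zero =>
    obtain rfl : b = 2 * h + 1 := by omega
    obtain rfl : s = h := by omega
    rw [sum132'_zero_succ x y q (s := h) rfl, ih h 0 (2 * h) h (by omega) (by push_cast; ring),
      add_assoc, ih (h + 1) 1 (2 * h + 1) h (by omega) (by push_cast; ring)]
    have e1 : (h + 1) * (h + 1 - 1) + triangle ((1 : ℕ) - (h + 1 : ℕ)) =
        h * h + triangle ((0 : ℕ) - h) + h := by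
      have h1 := two_mul_triangle ((1 : ℕ) - (h + 1 : ℕ))
      have h2 := two_mul_triangle ((0 : ℕ) - h)
      zify
      have h3 := cast_mul_pred (h + 1)
      push_cast at *
      linarith
    have e2 : h * h + triangle ((0 : ℕ) - h) = h * (h - 1) + triangle ((0 : ℕ) - h) + h := by
      zify
      have h3 := cast_mul_pred h
      push_cast at *
      linarith
    rw [e1, e2]
    ring
  | succ a =>
    rw [sum132'_succ x y q (by push_cast at hs; exact hs),
      ih h a b (s + 1) (by omega) (by push_cast at hs; linarith), add_assoc,
      ih (h + 1) (a + 2) b s (by omega) (by push_cast at hs ⊢; linarith)]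
    have e1 : (h + 1) * (h + 1 - 1) + triangle ((a + 2 : ℕ) - (h + 1 : ℕ)) =
        h * h + triangle ((a + 1 : ℕ) - h) + h := by
      have h1 := two_mul_triangle ((a + 2 : ℕ) - (h + 1 : ℕ))
      have h2 := two_mul_triangle ((a + 1 : ℕ) - h)
      zify
      have h3 := cast_mul_pred (h + 1)
      push_cast at *
      linarith
    have e2 : h * h + triangle ((a + 1 : ℕ) - h) = h * (h - 1) + triangle (a - h) + a := by
      have h1 := two_mul_triangle (a - h)
      have h2 := two_mul_triangle ((a + 1 : ℕ) - h)
      zify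
      have h3 := cast_mul_pred h
      push_cast at *
      linarith
    rw [e1, e2]
    ring

/-- Two half steps starting from a square corner also reach unbalanced ones, so the induction needs
all `a + b = 2 * h`; the triangular number records the imbalance. -/
theorem sum132_eq_motzkinSum (t : ℕ) : ∀ (h a b : ℕ) (s : ℤ), a + b = 2 * h → 2 * s = b - a →
    sum132 (weight132 x y q s) (t + h) a b =
      y ^ a * q ^ (h * (h - 1) + triangle (a - h)) * motzkinSum x y q t h := by
  induction t with
  | zero =>
    intro h a b s hab hs
    cases h with
    | zero =>
      obtain rfl : a = 0 := by omega
      obtain rfl : b = 0 := by omega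
      simp [sum132_zero, motzkinSum, triangle]
    | succ h =>
      rw [sum132_eq_zero _ (by omega)]
      simp [motzkinSum]
  | succ t ih =>
    intro h a b s hab hs
    have odd := sum132'_of_sum132 x y q ih
    cases h with
    | zero =>
      obtain rfl : a = 0 := by omega
      obtain rfl : b = 0 := by omega
      obtain rfl : s = 0 := by simpa using hs
      rw [add_zero, sum132_succ_zero_zero, ih 1 1 1 0 rfl rfl]
      have := ih 0 0 0 0 rfl rfl
      rw [add_zero] at this
      rw [this]
      simp [motzkinSum, triangle]
      ring
    | succ h =>
      cases b with
      | zero =>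
        obtain rfl : a = 2 * h + 1 + 1 := by omega
        obtain rfl : s = -(h + 1) := by push_cast at hs; linarith
        have o1 := odd h (2 * h + 1) 0 (-(h + 1)) (by omega) (by push_cast; ring)
        have o2 := odd (h + 1) (2 * h + 2) 1 (-(h + 1)) (by omega) (by push_cast; ring)
        rw [show t + 1 + (h + 1) = t + h + 1 + 1 by ring,
          sum132_succ_zero x y q (e := h) (by push_cast; ring) rfl, o1,
          show t + h + 1 + 1 = t + (h + 1) + 1 by ring, o2, motzkinSum]
        have e1 : (h + 1) * (h + 1) + triangle ((2 * h + 2 : ℕ) - (h + 1 : ℕ)) =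
            (h + 1) * (h + 1 - 1) + triangle ((2 * h + 1 + 1 : ℕ) - (h + 1 : ℕ)) + (h + 1) := by
          zify
          have h3 := cast_mul_pred (h + 1)
          push_cast at *
          rw [show (2 * h + 1 + 1 - (h + 1) : ℤ) = 2 * h + 2 - (h + 1) by ring]
          linarith
        have e2 : (h + 1) * (h + 1 - 1) + triangle ((2 * h + 1 + 1 : ℕ) - (h + 1 : ℕ)) =
            h * h + triangle ((2 * h + 1 : ℕ) - h) + h := by
          zify
          have h3 := cast_mul_pred (h + 1)
          push_cast at *
          rw [show (2 * h + 1 + 1 - (h + 1) : ℤ) = 2 * h + 1 - h by ring]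
          linarith
        rw [e1, e2]
        ring
      | succ b =>
        have o1 := odd h a b (s - 1) (by omega) (by push_cast at hs; linarith)
        have o2 := odd (h + 1) a (b + 2) s (by omega) (by push_cast at hs ⊢; linarith)
        rw [show t + 1 + (h + 1) = t + h + 1 + 1 by ring,
          sum132_succ x y q (by push_cast at hs; exact hs) (by omega), o1,
          show t + h + 1 + 1 = t + (h + 1) + 1 by ring, o2, motzkinSum]
        have hb : (b : ℤ) = 2 * h + 1 - a := by omega
        have e1 : (h + 1) * (h + 1) + triangle (a - (h + 1 : ℕ)) =
            (h + 1) * (h + 1 - 1) + triangle (a - (h + 1 : ℕ)) + (h + 1) := by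
          zify
          have h3 := cast_mul_pred (h + 1)
          push_cast at *
          linarith
        have e2 : (h + 1) * (h + 1 - 1) + triangle (a - (h + 1 : ℕ)) =
            h * h + triangle (a - h) + b := by
          have h1 := two_mul_triangle (a - (h + 1 : ℕ))
          have h2 := two_mul_triangle (a - h)
          zify
          have h3 := cast_mul_pred (h + 1)
          push_cast at *
          rw [hb]
          linarith
        rw [e1, e2]
        ring

end Weight132

/-! ### Crossings as sums of contributions of single points -/

section Crossings

/-- Such a set is a final segment of the numbers below `n`, so it contains, or is contained in, the
interval from `k` to `n`. -/
theorem card_filter_le_of_upward_closed (A : Finset ℕ) (n k : ℕ) (hA : ∀ a ∈ A, a < n)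
    (hup : ∀ a ∈ A, ∀ b, a ≤ b → b < n → b ∈ A) : #{a ∈ A | k ≤ a} = min #A (n - k) := by
  by_cases h : ∃ a ∈ A, a < k
  · obtain ⟨a, ha, hak⟩ := h
    have h1 : {a ∈ A | k ≤ a} = Finset.Ico k n := by
      ext b
      simp only [mem_filter, mem_Ico]
      exact ⟨fun hb => ⟨hb.2, hA b hb.1⟩, fun hb => ⟨hup a ha b (by omega) hb.2, hb.1⟩⟩
    have h2 := Finset.card_le_card (Finset.filter_subset (fun a => k ≤ a) A)
    rw [h1, Nat.card_Ico] at *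
    exact (min_eq_right h2).symm
  · push Not at h
    rw [Finset.filter_true_of_mem h]
    have : A ⊆ Finset.Ico k n := fun a ha => mem_Ico.2 ⟨h a ha, hA a ha⟩
    have := Finset.card_le_card this
    rw [Nat.card_Ico] at this
    exact (min_eq_left this).symm

variable {n : ℕ} {σ : Equiv.Perm (Fin n)}

/-- The values to the lower left of `j` are upward closed below `σ j`: a value in between placed
after `j` would complete a 132. The crossings are those values that exceed `j`. -/
theorem Avoids132.card_upper (hσ : Avoids132 σ) (j : Fin n) :
    #{i : Fin n | i < j ∧ j < σ i ∧ σ i < σ j} = min (lowerLeft σ j) (σ j - j - 1) := by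
  have hinj : Function.Injective fun i : Fin n => (σ i : ℕ) :=
    Fin.val_injective.comp σ.injective
  have h := card_filter_le_of_upward_closed
    (Finset.image (fun i : Fin n => (σ i : ℕ)) {i : Fin n | i < j ∧ σ i < σ j}) (σ j) (j + 1)
    (by rintro a ha; obtain ⟨i, hi, rfl⟩ := mem_image.1 ha; exact (mem_filter.1 hi).2.2) ?_
  · rw [Finset.card_image_of_injective _ hinj, Finset.filter_image,
      Finset.card_image_of_injective _ hinj, Finset.filter_filter] at h
    rw [lowerLeft, Nat.sub_sub, ← h]
    congr 1
    ext i
    simp only [mem_filter, mem_univ, true_and, Fin.lt_def]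
    omega
  · intro a ha b hab hb
    simp only [mem_image, mem_filter, mem_univ, true_and] at ha ⊢
    obtain ⟨i, ⟨hij, hi⟩, rfl⟩ := ha
    have hbn : b < n := by omega
    have hk : σ (σ⁻¹ ⟨b, hbn⟩) = ⟨b, hbn⟩ := by simp
    refine ⟨σ⁻¹ ⟨b, hbn⟩, ⟨?_, ?_⟩, by rw [hk]⟩
    · by_contra hlt
      have hne : σ⁻¹ ⟨b, hbn⟩ ≠ j := by
        intro h
        rw [h] at hk
        rw [hk] at hb
        simp at hb
      have hne' : σ i ≠ σ (σ⁻¹ ⟨b, hbn⟩) := by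
        intro h
        have := σ.injective h
        rw [← this] at hlt
        exact hlt hij
      refine hσ i j _ hij (lt_of_le_of_ne (not_lt.1 hlt) hne.symm) (lt_of_le_of_ne ?_ hne') ?_
      · rw [hk]
        exact hab
      · rw [hk]
        exact hb
    · rw [hk]
      exact hb

/-- The same argument with positions in place of values. -/
theorem Avoids132.card_lower (hσ : Avoids132 σ) (j : Fin n) :
    #{i : Fin n | σ i < σ j ∧ σ j ≤ i ∧ i < j} = min (lowerLeft σ j) (j - σ j) := by
  have hinj : Function.Injective fun i : Fin n => (i : ℕ) := Fin.val_injective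
  have h := card_filter_le_of_upward_closed
    (Finset.image (fun i : Fin n => (i : ℕ)) {i : Fin n | i < j ∧ σ i < σ j}) j (σ j)
    (by rintro a ha; obtain ⟨i, hi, rfl⟩ := mem_image.1 ha; exact (mem_filter.1 hi).2.1) ?_
  · rw [Finset.card_image_of_injective _ hinj, Finset.filter_image,
      Finset.card_image_of_injective _ hinj, Finset.filter_filter] at h
    rw [lowerLeft, ← h]
    congr 1
    ext i
    simp only [mem_filter, mem_univ, true_and, Fin.lt_def, Fin.le_def]
    omega
  · intro a ha b hab hb
    simp only [mem_image, mem_filter, mem_univ, true_and] at ha ⊢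
    obtain ⟨i, ⟨hij, hi⟩, rfl⟩ := ha
    refine ⟨⟨b, by omega⟩, ⟨hb, ?_⟩, rfl⟩
    by_contra hlt
    have hbj : (⟨b, by omega⟩ : Fin n) < j := hb
    have hib : i < (⟨b, by omega⟩ : Fin n) := by
      refine lt_of_le_of_ne hab fun h => ?_
      rw [← h] at hlt
      exact hlt hi
    exact hσ i _ j hib hbj hi (lt_of_le_of_ne (not_lt.1 hlt) fun h => hbj.ne' (σ.injective h))

theorem Avoids132.crs_eq (hσ : Avoids132 σ) :
    crs n σ = ∑ j, if j < σ j then min (lowerLeft σ j) (σ j - j - 1)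
      else min (lowerLeft σ j) (j - σ j) := by
  rw [crs, Finset.card_filter, Fintype.sum_prod_type_right]
  refine Finset.sum_congr rfl fun j _ => ?_
  rw [← Finset.card_filter]
  split_ifs with h
  · rw [← hσ.card_upper]
    congr 1
    ext i
    simp only [mem_filter, mem_univ, true_and, Fin.lt_def, Fin.le_def] at *
    omega
  · rw [← hσ.card_lower]
    congr 1
    ext i
    simp only [mem_filter, mem_univ, true_and, Fin.lt_def, Fin.le_def] at *
    omega

theorem exists_lt_apply_le {i j : Fin n} (hij : i ≤ j) (h : j < σ i) :
    ∃ l, j < l ∧ σ l ≤ j := by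
  have h1 := card_le_lt_eq_card_lt_le σ j
  have h2 : 0 < #{i : Fin n | i ≤ j ∧ j < σ i} :=
    Finset.card_pos.2 ⟨i, by simp [hij, h]⟩
  rw [h1, Finset.card_pos] at h2
  obtain ⟨l, hl⟩ := h2
  exact ⟨l, by simpa using hl⟩

theorem exists_le_lt_apply {l j : Fin n} (hij : j < l) (h : σ l ≤ j) :
    ∃ i, i ≤ j ∧ j < σ i := by
  have h1 := card_le_lt_eq_card_lt_le σ j
  have h2 : 0 < #{i : Fin n | j < i ∧ σ i ≤ j} :=
    Finset.card_pos.2 ⟨l, by simp [hij, h]⟩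
  rw [← h1, Finset.card_pos] at h2
  obtain ⟨i, hi⟩ := h2
  exact ⟨i, by simpa using hi⟩

/-- The sum counts pairs `i < j < σ i`. If `σ i < σ j`, the pair is an upper crossing. Otherwise `σ
j < j`, since some later `l` has `σ l ≤ j` and would complete a 321. For fixed `j` with `σ j < j`,
there are as many such `i` as `l > j` with `σ l ≤ j`, and each of these `l` forms a lower crossing
with `j`, again by avoidance. -/
theorem Avoids321.crs_eq (hσ : Avoids321 σ) :
    crs n σ = ∑ i : Fin n, if i < σ i then (σ i - i - 1 : ℕ) else 0 := by
  have h1 : (∑ i : Fin n, if i < σ i then (σ i - i - 1 : ℕ) else 0) =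
      #{p : Fin n × Fin n | p.1 < p.2 ∧ p.2 < σ p.1} := by
    rw [Finset.card_filter, Fintype.sum_prod_type]
    refine Finset.sum_congr rfl fun i _ => ?_
    rw [← Finset.card_filter]
    have : ({j : Fin n | i < j ∧ j < σ i} : Finset (Fin n)) = Finset.Ioo i (σ i) := by
      ext j
      simp
    rw [this, Fin.card_Ioo]
    split_ifs with h
    · rfl
    · rw [Fin.lt_def] at h
      omega
  have h2 : crs n σ = #{p : Fin n × Fin n | p.1 < p.2 ∧ p.2 < σ p.1 ∧ σ p.1 < σ p.2} +
      #{p : Fin n × Fin n | σ p.1 < σ p.2 ∧ σ p.2 ≤ p.1 ∧ p.1 < p.2} := by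
    rw [crs, ← Finset.card_union_of_disjoint, Finset.filter_or]
    rw [Finset.disjoint_filter]
    rintro p - h3 h4
    simp only [Fin.lt_def, Fin.le_def] at *
    omega
  have h3 : #{p : Fin n × Fin n | p.1 < p.2 ∧ p.2 < σ p.1} =
      #{p : Fin n × Fin n | p.1 < p.2 ∧ p.2 < σ p.1 ∧ σ p.1 < σ p.2} +
      #{p : Fin n × Fin n | p.1 < p.2 ∧ p.2 < σ p.1 ∧ σ p.2 < p.2} := by
    rw [← Finset.card_union_of_disjoint]
    · congr 1
      ext ⟨i, j⟩
      simp only [mem_filter, mem_univ, true_and, mem_union]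
      constructor
      · rintro ⟨hij, hj⟩
        rcases lt_or_ge (σ i) (σ j) with h | h
        · exact Or.inl ⟨hij, hj, h⟩
        · refine Or.inr ⟨hij, hj, ?_⟩
          by_contra hlt
          obtain ⟨l, hl, hl'⟩ := exists_lt_apply_le hij.le hj
          refine hσ i j l hij hl (lt_of_le_of_ne h fun h => hij.ne' (σ.injective h)) ?_
          exact lt_of_le_of_ne (hl'.trans (not_lt.1 hlt)) fun h => hl.ne' (σ.injective h)
      · rintro (h | h) <;> exact ⟨h.1, h.2.1⟩
    · rw [Finset.disjoint_filter]
      rintro p - h3 h4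
      simp only [Fin.lt_def] at *
      omega
  have h4 : #{p : Fin n × Fin n | p.1 < p.2 ∧ p.2 < σ p.1 ∧ σ p.2 < p.2} =
      #{p : Fin n × Fin n | σ p.1 < σ p.2 ∧ σ p.2 ≤ p.1 ∧ p.1 < p.2} := by
    rw [Finset.card_filter, Fintype.sum_prod_type_right, Finset.card_filter,
      Fintype.sum_prod_type]
    refine Finset.sum_congr rfl fun j _ => ?_
    rw [← Finset.card_filter, ← Finset.card_filter]
    by_cases hj : σ j < j
    · trans #{i : Fin n | i ≤ j ∧ j < σ i}
      · congr 1
        ext i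
        simp only [mem_filter, mem_univ, true_and]
        constructor
        · rintro ⟨h5, h6, -⟩
          exact ⟨h5.le, h6⟩
        · rintro ⟨h5, h6⟩
          refine ⟨lt_of_le_of_ne h5 ?_, h6, hj⟩
          rintro rfl
          exact lt_asymm hj h6
      · rw [card_le_lt_eq_card_lt_le]
        congr 1
        ext l
        simp only [mem_filter, mem_univ, true_and]
        constructor
        · rintro ⟨h5, h6⟩
          refine ⟨?_, h6, h5⟩
          by_contra hlt
          obtain ⟨i, hi, hi'⟩ := exists_le_lt_apply h5 h6
          refine hσ i j l (lt_of_le_of_ne hi ?_) h5 (hj.trans hi')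
            (lt_of_le_of_ne (not_lt.1 hlt) fun h => h5.ne' (σ.injective h))
          rintro rfl
          exact lt_asymm hj hi'
        · rintro ⟨-, h6, h5⟩
          exact ⟨h5, h6⟩
    · rw [Finset.filter_false_of_mem, Finset.filter_false_of_mem]
      · rintro l - ⟨h5, h6, -⟩
        exact hj (h5.trans_le h6)
      · rintro i - ⟨-, -, h5⟩
        exact hj h5
  omega

theorem prod_pow_stat {R : Type*} [CommSemiring R] (x y q : R) (c : Fin n → ℕ) :
    ∏ i, ((if σ i = i then x else 1) * (if i < σ i then y else 1) * q ^ c i) =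
      x ^ fp n σ * y ^ exc n σ * q ^ ∑ i, c i := by
  rw [Finset.prod_mul_distrib, Finset.prod_mul_distrib, Finset.prod_ite, Finset.prod_ite,
    Finset.prod_pow_eq_pow_sum]
  simp [fp, exc]

theorem Avoids321.prod_weight {R : Type*} [CommSemiring R] (x y q : R) (hσ : Avoids321 σ) :
    ∏ j : Fin n, weight321 x y q j (σ j) = x ^ fp n σ * y ^ exc n σ * q ^ crs n σ := by
  rw [hσ.crs_eq, ← prod_pow_stat]
  refine Finset.prod_congr rfl fun j _ => ?_
  rw [weight321]
  simp only [Fin.lt_def, Fin.ext_iff]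
  split_ifs <;> first | omega | simp

theorem Avoids132.prod_weight {R : Type*} [CommSemiring R] (x y q : R) (hσ : Avoids132 σ) :
    ∏ j : Fin n, weight132 x y q 0 j (σ j) (lowerLeft σ j) =
      x ^ fp n σ * y ^ exc n σ * q ^ crs n σ := by
  rw [hσ.crs_eq, ← prod_pow_stat]
  refine Finset.prod_congr rfl fun j _ => ?_
  rw [weight132]
  simp only [Fin.lt_def, Fin.ext_iff]
  split_ifs with h1 h2 h3 h4 h5 h6 <;> first | omega | skip
  · rw [show ((σ j : ℕ) - (j : ℕ) - 0 - 1 : ℤ).toNat = (σ j : ℕ) - j - 1 by omega]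
    simp
  · simp [*]
  · rw [show ((j : ℕ) + 0 - (σ j : ℕ) : ℤ).toNat = (j : ℕ) - σ j by omega]
    simp

end Crossings

/-! ### The three equivalences -/

section Equidistribution

theorem genPoly_fp_exc_crs (T : Set (Σ k : ℕ, Equiv.Perm (Fin k))) (n : ℕ) :
    genPoly ![fp, exc, crs] T n = ∑ σ ∈ avoiders T n,
      MvPolynomial.X 0 ^ fp n σ * MvPolynomial.X 1 ^ exc n σ * MvPolynomial.X 2 ^ crs n σ := by
  refine Finset.sum_congr rfl fun σ _ => ?_
  rw [Fin.prod_univ_three]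
  rfl

theorem genPoly_p321 (n : ℕ) : genPoly ![fp, exc, crs] {⟨3, p321⟩} n =
    motzkinSum (MvPolynomial.X 0) (MvPolynomial.X 1) (MvPolynomial.X 2) n 0 := by
  classical
  have h := sum321_eq_motzkinSum (MvPolynomial.X 0 : MvPolynomial (Fin 3) ℤ)
    (MvPolynomial.X 1) (MvPolynomial.X 2) n 0
  rw [pow_zero, zero_mul, pow_zero, one_mul, one_mul, add_zero] at h
  rw [← h, genPoly_fp_exc_crs, sum321]
  refine Finset.sum_congr ?_ fun σ hσ => ?_
  · ext σ
    rw [mem_avoiders_singleton, not_contains_p321_iff]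
    simp [Corner321]
  · rw [(mem_filter.1 hσ).2.1.prod_weight]

theorem genPoly_p132 (n : ℕ) : genPoly ![fp, exc, crs] {⟨3, p132⟩} n =
    motzkinSum (MvPolynomial.X 0) (MvPolynomial.X 1) (MvPolynomial.X 2) n 0 := by
  classical
  have h := sum132_eq_motzkinSum (MvPolynomial.X 0 : MvPolynomial (Fin 3) ℤ)
    (MvPolynomial.X 1) (MvPolynomial.X 2) n 0 0 0 0 rfl rfl
  rw [pow_zero, one_mul, add_zero, show 0 * (0 - 1) + triangle ((0 : ℕ) - (0 : ℕ)) = 0 by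
    simp [triangle], pow_zero, one_mul] at h
  rw [← h, genPoly_fp_exc_crs, sum132]
  refine Finset.sum_congr ?_ fun σ hσ => ?_
  · ext σ
    rw [mem_avoiders_singleton, not_contains_p132_iff]
    simp only [mem_filter, mem_univ, true_and]
    exact ⟨fun h => ⟨h, by simp, fun i _ => by omega, fun i _ => by omega, fun i => by omega⟩,
      fun h => h.avoids⟩
  · rw [(mem_filter.1 hσ).2.avoids.prod_weight]

theorem wilfEquiv_p132_p321 : WilfEquiv ![fp, exc, crs] {⟨3, p132⟩} {⟨3, p321⟩} := fun n => by
  rw [genPoly_p132, genPoly_p321]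

theorem antiTranspose_p132 : antiTranspose p132 = p213 := by decide

theorem inverse_p231 : p231⁻¹ = p312 := by decide

/-- The anti-transposition as a bijection. -/
def antiTransposeEquiv (n : ℕ) : Equiv.Perm (Equiv.Perm (Fin n)) :=
  Function.Involutive.toPerm antiTranspose antiTranspose_antiTranspose

theorem wilfEquiv_p132_p213 {ι : Type*} [Fintype ι] {st : ι → Stat}
    (hst : ∀ i n σ, st i n (antiTranspose σ) = st i n σ) :
    WilfEquiv st {⟨3, p132⟩} {⟨3, p213⟩} := by
  refine WilfEquiv.of_equiv antiTransposeEquiv (fun n σ => ?_) hst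
  rw [← antiTranspose_p132]
  exact contains_antiTranspose_iff

theorem wilfEquiv_p231_p312 : WilfEquiv ![fp, inv, nes] {⟨3, p231⟩} {⟨3, p312⟩} := by
  refine WilfEquiv.of_equiv (fun n => Equiv.inv _) (fun n σ => ?_) (fun i n σ => ?_)
  · rw [← inverse_p231]
    exact contains_inv_iff
  · fin_cases i
    · exact fp_inv σ
    · exact inv_inverse σ
    · exact nes_inv σ

end Equidistribution

/-! ### Finite checks in length 3 and the classes -/

section Classification

theorem fp_exc_inv_crs_nes_length_three (τ τ' : Equiv.Perm (Fin 3)) (hne : τ ≠ τ')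
    (h : ∀ i, (![fp, exc, inv, crs, nes] : Fin 5 → Stat) i 3 τ =
      (![fp, exc, inv, crs, nes] : Fin 5 → Stat) i 3 τ') :
    (τ = p132 ∧ τ' = p213) ∨ (τ = p213 ∧ τ' = p132) := by
  revert τ τ'
  decide +kernel

theorem fp_inv_nes_length_three (τ τ' : Equiv.Perm (Fin 3)) (hne : τ ≠ τ')
    (h : ∀ i, (![fp, inv, nes] : Fin 3 → Stat) i 3 τ =
      (![fp, inv, nes] : Fin 3 → Stat) i 3 τ') :
    (τ = p132 ∧ τ' = p213) ∨ (τ = p213 ∧ τ' = p132) ∨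
      (τ = p231 ∧ τ' = p312) ∨ (τ = p312 ∧ τ' = p231) := by
  revert τ τ'
  decide +kernel

theorem fp_exc_crs_length_three (τ τ' : Equiv.Perm (Fin 3)) (hne : τ ≠ τ')
    (h : ∀ i, (![fp, exc, crs] : Fin 3 → Stat) i 3 τ =
      (![fp, exc, crs] : Fin 3 → Stat) i 3 τ') :
    (τ = p132 ∨ τ = p213 ∨ τ = p321) ∧ (τ' = p132 ∨ τ' = p213 ∨ τ' = p321) := by
  revert τ τ'
  decide +kernel

theorem wilfClass_fp_exc_inv_crs_nes :
    wilfClass ![fp, exc, inv, crs, nes] p132 = {p132, p213} := by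
  ext τ
  simp only [wilfClass, Set.mem_ofPred_eq, Set.mem_insert_iff, Set.mem_singleton_iff]
  constructor
  · intro h
    by_cases hne : p132 = τ
    · exact Or.inl hne.symm
    · rcases fp_exc_inv_crs_nes_length_three _ _ hne h.stat_eq with h | h
      · exact Or.inr h.2
      · exact Or.inl h.2
  · rintro (rfl | rfl)
    · exact WilfEquiv.refl _
    · refine wilfEquiv_p132_p213 fun i n σ => ?_
      fin_cases i
      · exact fp_antiTranspose σ
      · exact exc_antiTranspose σ
      · exact inv_antiTranspose σ
      · exact crs_antiTranspose σ
      · exact nes_antiTranspose σ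

theorem wilfClass_fp_inv_nes_p132 : wilfClass ![fp, inv, nes] p132 = {p132, p213} := by
  ext τ
  simp only [wilfClass, Set.mem_ofPred_eq, Set.mem_insert_iff, Set.mem_singleton_iff]
  constructor
  · intro h
    by_cases hne : p132 = τ
    · exact Or.inl hne.symm
    · rcases fp_inv_nes_length_three _ _ hne h.stat_eq with h | h | h | h
      · exact Or.inr h.2
      · exact Or.inl h.2
      · exact absurd h.1 (by decide)
      · exact absurd h.1 (by decide)
  · rintro (rfl | rfl)
    · exact WilfEquiv.refl _
    · refine wilfEquiv_p132_p213 fun i n σ => ?_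
      fin_cases i
      · exact fp_antiTranspose σ
      · exact inv_antiTranspose σ
      · exact nes_antiTranspose σ

theorem wilfClass_fp_inv_nes_p231 : wilfClass ![fp, inv, nes] p231 = {p231, p312} := by
  ext τ
  simp only [wilfClass, Set.mem_ofPred_eq, Set.mem_insert_iff, Set.mem_singleton_iff]
  constructor
  · intro h
    by_cases hne : p231 = τ
    · exact Or.inl hne.symm
    · rcases fp_inv_nes_length_three _ _ hne h.stat_eq with h | h | h | h
      · exact absurd h.1 (by decide)
      · exact absurd h.1 (by decide)
      · exact Or.inr h.2
      · exact Or.inl h.2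
  · rintro (rfl | rfl)
    · exact WilfEquiv.refl _
    · exact wilfEquiv_p231_p312

theorem wilfClass_fp_exc_crs : wilfClass ![fp, exc, crs] p132 = {p132, p213, p321} := by
  ext τ
  simp only [wilfClass, Set.mem_ofPred_eq, Set.mem_insert_iff, Set.mem_singleton_iff]
  constructor
  · intro h
    by_cases hne : p132 = τ
    · exact Or.inl hne.symm
    · exact (fp_exc_crs_length_three _ _ hne h.stat_eq).2
  · rintro (rfl | rfl | rfl)
    · exact WilfEquiv.refl _
    · refine wilfEquiv_p132_p213 fun i n σ => ?_
      fin_cases i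
      · exact fp_antiTranspose σ
      · exact exc_antiTranspose σ
      · exact crs_antiTranspose σ
    · exact wilfEquiv_p132_p321

end Classification

end PermPattern

theorem mainTheorem7 :
    PermPattern.wilfClass
        ![PermPattern.fp, PermPattern.exc, PermPattern.inv, PermPattern.crs, PermPattern.nes]
        PermPattern.p132 = {PermPattern.p132, PermPattern.p213} ∧
    PermPattern.wilfClass ![PermPattern.fp, PermPattern.inv, PermPattern.nes]
        PermPattern.p231 = {PermPattern.p231, PermPattern.p312} ∧
    PermPattern.wilfClass ![PermPattern.fp, PermPattern.exc, PermPattern.crs]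
        PermPattern.p132 = {PermPattern.p132, PermPattern.p213, PermPattern.p321} ∧
    PermPattern.nonSingletonClasses
        ![PermPattern.fp, PermPattern.exc, PermPattern.inv, PermPattern.crs, PermPattern.nes] 3 =
      {{PermPattern.p132, PermPattern.p213}} ∧
    PermPattern.nonSingletonClasses ![PermPattern.fp, PermPattern.inv, PermPattern.nes] 3 =
      {{PermPattern.p132, PermPattern.p213}, {PermPattern.p231, PermPattern.p312}} ∧
    PermPattern.nonSingletonClasses ![PermPattern.fp, PermPattern.exc, PermPattern.crs] 3 =
      {{PermPattern.p132, PermPattern.p213, PermPattern.p321}} := by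
  open PermPattern in
  have h1 : p132 ≠ p213 := by decide
  have h2 : p231 ≠ p312 := by decide
  refine ⟨wilfClass_fp_exc_inv_crs_nes, wilfClass_fp_inv_nes_p231, wilfClass_fp_exc_crs,
    nonSingletonClasses_eq_of_stat _ ?_ ?_, nonSingletonClasses_eq_of_stat _ ?_ ?_,
    nonSingletonClasses_eq_of_stat _ ?_ ?_⟩
  · rintro C rfl
    exact ⟨Set.nontrivial_pair h1, _, wilfClass_fp_exc_inv_crs_nes.symm⟩
  · intro τ τ' hne h
    refine ⟨_, rfl, ?_⟩
    rcases fp_exc_inv_crs_nes_length_three τ τ' hne h with h | h <;> simp [h.1]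
  · rintro C (rfl | rfl)
    · exact ⟨Set.nontrivial_pair h1, _, wilfClass_fp_inv_nes_p132.symm⟩
    · exact ⟨Set.nontrivial_pair h2, _, wilfClass_fp_inv_nes_p231.symm⟩
  · intro τ τ' hne h
    rcases fp_inv_nes_length_three τ τ' hne h with h | h | h | h
    · exact ⟨_, Or.inl rfl, by simp [h.1]⟩
    · exact ⟨_, Or.inl rfl, by simp [h.1]⟩
    · exact ⟨_, Or.inr rfl, by simp [h.1]⟩
    · exact ⟨_, Or.inr rfl, by simp [h.1]⟩
  · rintro C rfl
    exact ⟨⟨_, by simp, _, by simp, h1⟩, _, wilfClass_fp_exc_crs.symm⟩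
  · intro τ τ' hne h
    exact ⟨_, rfl, by simpa using (fp_exc_crs_length_three τ τ' hne h).1⟩
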